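/- Let $G$ be a finite group. A set $X=\{C_1,\dots,C_t\}$ of conjugacy classes of $G$ is said to invariably generate $G$ if $\langle x_1,\dots,x_t\rangle=G$ for every choice of $x_1\in C_1,\dots,x_t\in C_t$. Theorem. There is an absolute constant $K$ such that the following holds for every prime power $q$. Let $S=\mathrm{PSL}_2(q)$, and let $C_1,C_2$ be conjugacy classes of $S$ chosen uniformly and independently at random from the finite set of all conjugacy classes of $S$ (each class being equally likely, and $C_1=C_2$ being allowed). Then $$\left|\,\mathbf P\bigl(\{C_1,C_2\}\text{ invariably generates }S\bigr)-\tfrac12\,\right|\le \frac{K}{q}.$$ -/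

import Mathlib

/-- A set `X` of conjugacy classes of `G` *invariably generates* `G` if, whichever element `x C` one
picks in each class `C ∈ X`, the elements picked generate `G`. -/
def InvariablyGenerates {G : Type*} [Group G] (X : Set (ConjClasses G)) : Prop :=
  ∀ x : ConjClasses G → G, (∀ C ∈ X, x C ∈ C.carrier) → Subgroup.closure (x '' X) = ⊤

/-- The probability that `{C₁, C₂}` invariably generates the finite group `G`, where `C₁`, `C₂` are
conjugacy classes of `G` chosen uniformly and independently at random (every class having the same
probability, regardless of its size): the proportion of such ordered pairs `(C₁, C₂)`. -/
noncomputable def invariableGenerationProb (G : Type*) [Group G] : ℝ :=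
  (Nat.card {p : ConjClasses G × ConjClasses G // InvariablyGenerates {p.1, p.2}} : ℝ) /
    (Nat.card (ConjClasses G × ConjClasses G) : ℝ)

/-!
Write `q` for the order of `F`. A conjugacy class of `PSL(2, F)` is determined by the square of the
trace of its elements, unless this square is `4`, and only three classes are excluded by that
condition (`PSL2.classTraceSq_injOn`, `PSL2.ncard_unipotent_classes_le`). The remaining classes are
split (square trace `(l + l⁻¹) ^ 2` with `l` in `F`) or nonsplit, and counting squares shows that
there are equally many of each kind up to a bounded error, and at least `q / 2` classes in all
(`PSL2.card_classes`). Two split classes both meet the stabilizer of a rational point of the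
projective line, and two nonsplit classes both meet the centralizer of one element; so neither pair
generates invariably. It remains to see that all but `O(q)` of the pairs consisting of a split and a
nonsplit class do.

Let `H` be a proper subgroup containing a split element `x` and a nonsplit element `y`, both of
order at least `4`, and let it act on the projective line over a finite extension of `F` in which
all eigenvalues lie. Nontrivial elements of `H` have two fixed points there, or one if they are
unipotent. Counting the pairs of a nontrivial element and a fixed point of it shows that the points
with nontrivial stabilizer form two orbits, one of rational points and one of irrational points,
and that, if `Q` is the unipotent group fixing the point `∞` fixed by `x`, the stabilizers of `∞`
and of a fixed point of `y` have order `|Q| (|Q| - 1)` and `|Q| + 1`, or half of that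
(`card_stabilizers_of_two_fixed_points`). The elements of `F` multiplying `Q`, seen as an additive
subgroup of `F`, into itself form a subfield, which has order `|Q|` because it contains more than
`(|Q| - 1) / 2` multipliers of elements of `H`. If it were all of `F`, then `H` would contain a full
group of transvections and be everything. So `m = |Q|` is the order of a proper subfield, whence
`m ^ 2 ≤ q`, and `x ^ (m - 1) = 1`, `y ^ (m + 1) = 1` (`PSL2.exists_subfield_card_of_ne_top`).

At most `2 n` semisimple classes satisfy `g ^ n = 1`. Hence a given `m` accounts for at most
`4 m ^ 2` pairs of classes, and summing over the powers `m` of the characteristic with `m ^ 2 ≤ q`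
gives `O(q)` (`PSL2.ncard_badPairs_le`); elements of order less than `4` contribute another `O(q)`.
-/

open MulAction
open scoped MatrixGroups

/-! ### Groups whose nontrivial elements have one or two fixed points -/

section OrbitCount

variable {G Ω : Type*} [Group G] [MulAction G Ω]

theorem natCard_stabilizer_smul (g : G) (w : Ω) :
    Nat.card (stabilizer G (g • w)) = Nat.card (stabilizer G w) :=
  Nat.card_congr (stabilizerEquivStabilizerOfOrbitRel
    (orbitRel_apply.2 (mem_orbit w g))).toEquiv

theorem ncard_orbit_mul_natCard_stabilizer (w : Ω) :
    (orbit G w).ncard * Nat.card (stabilizer G w) = Nat.card G := by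
  rw [← Nat.card_coe_set_eq, ← Nat.card_prod]
  exact Nat.card_congr (orbitProdStabilizerEquivGroup G w)

theorem ncard_fixing_add_one [Finite G] (w : Ω) :
    {g : G | g ≠ 1 ∧ g • w = w}.ncard + 1 = Nat.card (stabilizer G w) := by
  have h : {g : G | g ≠ 1 ∧ g • w = w} = (stabilizer G w : Set G) \ {1} := by
    ext g; simp [mem_stabilizer_iff, and_comm]
  rw [h, Set.ncard_sdiff_singleton_add_one (one_mem (stabilizer G w)) (Set.toFinite _)]
  rfl

/-- The points of one orbit account for `|G| - |orbit|` pairs `(g, ω)` with `g ≠ 1` fixing `ω`. -/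
theorem sum_orbit_ncard_fixing [Finite G] [Finite Ω] (w : Ω) {s : Finset Ω}
    (hs : (s : Set Ω) = orbit G w) :
    ∑ v ∈ s, {g : G | g ≠ 1 ∧ g • v = v}.ncard + (orbit G w).ncard = Nat.card G := by
  have hc : (orbit G w).ncard = s.card := by rw [← hs, Set.ncard_coe_finset]
  have h1 : ∀ v ∈ s, {g : G | g ≠ 1 ∧ g • v = v}.ncard + 1 = Nat.card (stabilizer G w) := by
    intro v hv
    have hv' : v ∈ orbit G w := by rw [← hs]; exact hv
    obtain ⟨g, rfl⟩ := hv'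
    simp only
    rw [ncard_fixing_add_one, natCard_stabilizer_smul]
  rw [← ncard_orbit_mul_natCard_stabilizer w, hc, Finset.card_eq_sum_ones, ← Finset.sum_add_distrib,
    Finset.sum_congr rfl h1]
  simp

theorem sum_ncard_fixing [Finite G] [Fintype Ω] (s : Finset G)
    (hs : ∀ g, g ∈ s ↔ g ≠ 1) :
    ∑ v : Ω, {g : G | g ≠ 1 ∧ g • v = v}.ncard = ∑ g ∈ s, (fixedBy Ω g).ncard := by
  classical
  have h := Finset.sum_card_bipartiteAbove_eq_sum_card_bipartiteBelow
    (s := (Finset.univ : Finset Ω)) (t := s) (fun v g => g • v = v)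
  convert h using 2 with v _ g hg
  · rw [← Set.ncard_coe_finset]
    congr 1
    ext g
    simp [Finset.bipartiteAbove, hs]
  · rw [← Set.ncard_coe_finset]
    congr 1
    ext g
    simp [Finset.bipartiteBelow]

/-- A subgroup fixing `p` and acting freely on the rest of a set `T ∋ p` that it preserves
has order dividing `|T| - 1`. -/
theorem card_dvd_of_free_off_point [Finite Ω] {T : Set Ω} {p : Ω} (hp : p ∈ T)
    (Q : Subgroup G) (hT : ∀ g ∈ Q, ∀ w ∈ T, g • w ∈ T) (hfix : ∀ g ∈ Q, g • p = p)
    (hfree : ∀ g ∈ Q, ∀ w ∈ T, w ≠ p → g • w = w → g = 1) :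
    ∃ c, T.ncard = 1 + c * Nat.card Q := by
  let X : SubMulAction Q Ω :=
    { carrier := T \ {p}
      smul_mem' := by
        rintro ⟨g, hg⟩ w ⟨hw, hwp⟩
        refine ⟨hT g hg w hw, fun h => hwp ?_⟩
        have h' : g • w = p := h
        rw [← hfix g hg] at h'
        exact smul_left_cancel g h' }
  have e := selfEquivOrbitsQuotientProd (G := Q) (X := X) (by
    rintro ⟨w, hw, hwp⟩
    rw [eq_bot_iff]
    rintro ⟨g, hg⟩ hgw
    have h2 : g • w = w := congrArg Subtype.val (mem_stabilizer_iff.1 hgw)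
    simpa [Subgroup.mem_bot, Subtype.ext_iff] using hfree g hg w hw hwp h2)
  refine ⟨Nat.card (Quotient (orbitRel Q X)), ?_⟩
  rw [← Nat.card_prod, ← Nat.card_congr e]
  have : Nat.card X = (T \ {p}).ncard := Nat.card_coe_set_eq _
  rw [this, add_comm, Set.ncard_sdiff_singleton_add_one hp (Set.toFinite _)]

/-- The arithmetic of the orbit count. The two orbits have lengths `a` and `b`, the group has
order `g`, and the point stabilizers have orders `q * k` and `r`. Eliminating `a`, `b` and `g` gives
`(1 + c * (q - 2)) * (r - k) = 2 * c * k`, so that `r - k` is `1` or `2`, and then `c = 1`. -/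
theorem orders_of_orbit_equation {q k r c a b g : ℕ} (ha : a = 1 + c * q) (hc : c ≠ 0)
    (hga : a * (q * k) = g) (hgb : b * r = g) (hab : a + b = 2 + a * (q - 1))
    (hk : 4 ≤ k) (hkq : k + 1 ≤ q) :
    (k + 1 = q ∧ r = q + 1) ∨ (2 * k + 1 = q ∧ 2 * r = q + 1) := by
  obtain ⟨s, rfl⟩ : ∃ s, q = s + 2 := ⟨q - 2, by omega⟩
  have hb : b = (s + 2) * (1 + c * s) := by
    have : a + b = a + (s + 2) * (1 + c * s) := by
      rw [hab, ha, show s + 2 - 1 = s + 1 by omega]; ring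
    omega
  have h1 : (1 + c * s) * r = k * (1 + c * (s + 2)) := by
    have : (s + 2) * ((1 + c * s) * r) = (s + 2) * (k * (1 + c * (s + 2))) := by
      rw [← mul_assoc, ← hb, hgb, ← hga, ha]; ring
    exact Nat.eq_of_mul_eq_mul_left (by omega) this
  have hr : k < r := by
    by_contra! h
    have := Nat.mul_le_mul_left (1 + c * s) h
    have h2 : 0 < k * c := by positivity
    nlinarith
  obtain ⟨i, rfl⟩ : ∃ i, r = k + i := ⟨r - k, by omega⟩
  have h2 : (1 + c * s) * i = 2 * c * k := by nlinarith
  have hi3 : i < 3 := by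
    by_contra! h
    have h3 := Nat.mul_le_mul_left (1 + c * s) h
    have h4 : 2 * c * k ≤ 2 * c * (s + 1) := Nat.mul_le_mul_left _ (by omega)
    have h5 : c * 3 ≤ c * s := Nat.mul_le_mul_left _ (by omega)
    nlinarith
  obtain ⟨t, ht⟩ : ∃ t, t * c = 1 := by
    have : i = 1 ∨ i = 2 := by omega
    have hdvd : (c : ℤ) ∣ 1 := by
      rcases this with rfl | rfl
      · exact ⟨2 * k - s, by push_cast [mul_sub]; zify at h2; linarith⟩
      · exact ⟨k - s, by zify at h2; linarith⟩
    obtain ⟨t, ht⟩ := (Int.natCast_dvd_natCast (n := 1)).1 (by simpa using hdvd)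
    exact ⟨t, by rw [mul_comm]; exact ht.symm⟩
  obtain ⟨-, rfl⟩ : t = 1 ∧ c = 1 := by simpa using ht
  have : i = 1 ∨ i = 2 := by omega
  rcases this with rfl | rfl
  · right; omega
  · left; omega

theorem sum_fixing_add_unipotent [Finite G] [Fintype Ω]
    (hfix : ∀ g : G, g ≠ 1 → (fixedBy Ω g).ncard = 1 ∨ (fixedBy Ω g).ncard = 2) :
    ∑ v : Ω, {g : G | g ≠ 1 ∧ g • v = v}.ncard +
      {g : G | g ≠ 1 ∧ (fixedBy Ω g).ncard = 1}.ncard + 2 = 2 * Nat.card G := by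
  classical
  have := Fintype.ofFinite G
  rw [sum_ncard_fixing (Finset.univ.erase 1) (by simp)]
  have h1 : {g : G | g ≠ 1 ∧ (fixedBy Ω g).ncard = 1}.ncard =
      ∑ g ∈ Finset.univ.erase (1 : G), if (fixedBy Ω g).ncard = 1 then 1 else 0 := by
    rw [← Finset.card_filter, ← Set.ncard_coe_finset]
    congr 1
    ext g; simp
  rw [h1, ← Finset.sum_add_distrib, Finset.sum_congr rfl (g := fun _ => 2)]
  · have h2 := Finset.card_erase_add_one (Finset.mem_univ (1 : G))
    rw [Finset.card_univ, ← Nat.card_eq_fintype_card] at h2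
    simp only [Finset.sum_const, smul_eq_mul]
    omega
  · intro g hg
    rcases hfix g (Finset.ne_of_mem_erase hg) with h | h <;> simp [h]

theorem disjoint_orbit_of_notMem {v w : Ω} (h : w ∉ orbit G v) :
    Disjoint (orbit G v) (orbit G w) := by
  rw [Set.disjoint_left]
  intro x hx hx'
  exact h ((orbit_eq_iff.2 hx) ▸ (orbit_eq_iff.2 hx') ▸ mem_orbit_self w)

/-- If every nontrivial element of `G` has one or two fixed points, and `p`, `r` are points of
different orbits with stabilizers of order at least `4`, then every point with nontrivial
stabilizer lies in one of these two orbits: there are fewer than `2 * |G|` pairs `(g, v)` with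
`g ≠ 1` fixing `v`, and the two orbits together with a third one would give that many. -/
theorem mem_orbit_or_mem_orbit [Finite G] [Finite Ω]
    (hfix : ∀ g : G, g ≠ 1 → (fixedBy Ω g).ncard = 1 ∨ (fixedBy Ω g).ncard = 2)
    {p r v : Ω} (hpr : r ∉ orbit G p) (np : 4 ≤ Nat.card (stabilizer G p))
    (nr : 4 ≤ Nat.card (stabilizer G r)) (nv : 2 ≤ Nat.card (stabilizer G v)) :
    v ∈ orbit G p ∨ v ∈ orbit G r := by
  classical
  have := Fintype.ofFinite Ω
  by_contra! h
  have hs : ∀ w : Ω, ((orbit G w).toFinite.toFinset : Set Ω) = orbit G w := by simp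
  have e1 := sum_orbit_ncard_fixing p (hs p)
  have e2 := sum_orbit_ncard_fixing r (hs r)
  have e3 := sum_orbit_ncard_fixing v (hs v)
  have c1 := Nat.mul_le_mul_left (orbit G p).ncard np
  have c2 := Nat.mul_le_mul_left (orbit G r).ncard nr
  have c3 := Nat.mul_le_mul_left (orbit G v).ncard nv
  rw [ncard_orbit_mul_natCard_stabilizer] at c1 c2 c3
  have hd : ∀ {a b : Ω}, b ∉ orbit G a →
      Disjoint (orbit G a).toFinite.toFinset (orbit G b).toFinite.toFinset := by
    intro a b hab
    rw [← Finset.disjoint_coe, hs, hs]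
    exact disjoint_orbit_of_notMem hab
  have d : Disjoint ((orbit G p).toFinite.toFinset ∪ (orbit G r).toFinite.toFinset)
      (orbit G v).toFinite.toFinset :=
    Finset.disjoint_union_left.2 ⟨hd h.1, hd h.2⟩
  have tot := sum_fixing_add_unipotent hfix
  have le := Finset.sum_le_univ_sum_of_nonneg
    (f := fun v : Ω => {g : G | g ≠ 1 ∧ g • v = v}.ncard)
    (s := ((orbit G p).toFinite.toFinset ∪ (orbit G r).toFinite.toFinset) ∪
      (orbit G v).toFinite.toFinset) (fun _ => Nat.zero_le _)
  rw [Finset.sum_union d, Finset.sum_union (hd hpr)] at le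
  omega

theorem ncard_orbit_add_ncard_orbit [Finite G] [Finite Ω]
    (hfix : ∀ g : G, g ≠ 1 → (fixedBy Ω g).ncard = 1 ∨ (fixedBy Ω g).ncard = 2)
    {p r : Ω} (hpr : r ∉ orbit G p) (np : 4 ≤ Nat.card (stabilizer G p))
    (nr : 4 ≤ Nat.card (stabilizer G r)) :
    (orbit G p).ncard + (orbit G r).ncard =
      2 + {g : G | g ≠ 1 ∧ (fixedBy Ω g).ncard = 1}.ncard := by
  classical
  have := Fintype.ofFinite Ω
  have hs : ∀ w : Ω, ((orbit G w).toFinite.toFinset : Set Ω) = orbit G w := by simp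
  have e1 := sum_orbit_ncard_fixing p (hs p)
  have e2 := sum_orbit_ncard_fixing r (hs r)
  have hd : Disjoint (orbit G p).toFinite.toFinset (orbit G r).toFinite.toFinset := by
    rw [← Finset.disjoint_coe, hs, hs]
    exact disjoint_orbit_of_notMem hpr
  have tot := sum_fixing_add_unipotent hfix
  have eq := Finset.sum_subset (Finset.subset_univ
      ((orbit G p).toFinite.toFinset ∪ (orbit G r).toFinite.toFinset))
    (f := fun v : Ω => {g : G | g ≠ 1 ∧ g • v = v}.ncard) (by
      intro v _ hv
      simp only [Finset.mem_union, Set.Finite.mem_toFinset] at hv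
      by_contra h0
      refine hv (mem_orbit_or_mem_orbit hfix hpr np nr ?_)
      rw [← ncard_fixing_add_one]
      omega)
  rw [Finset.sum_union hd] at eq
  omega

/-- If all elements with exactly one fixed point have it in the orbit of `p`, then there are
`|orbit| * (|Q| - 1)` of them, where `Q` consists of those fixing `p` (and of `1`). -/
theorem ncard_unipotent [Finite G] [Finite Ω] {p : Ω}
    (hone : ∀ g : G, g ≠ 1 → (fixedBy Ω g).ncard = 1 → fixedBy Ω g ⊆ orbit G p)
    (Q : Subgroup G) (hQ : ∀ g, g ∈ Q ↔ g = 1 ∨ (g • p = p ∧ (fixedBy Ω g).ncard = 1)) :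
    {g : G | g ≠ 1 ∧ (fixedBy Ω g).ncard = 1}.ncard =
      (orbit G p).ncard * (Nat.card Q - 1) := by
  classical
  have := Fintype.ofFinite Ω
  have := Fintype.ofFinite G
  set U : Finset G := {g : G | g ≠ 1 ∧ (fixedBy Ω g).ncard = 1}.toFinite.toFinset
  set O : Finset Ω := (orbit G p).toFinite.toFinset
  have hU : ∀ g, g ∈ U ↔ g ≠ 1 ∧ (fixedBy Ω g).ncard = 1 := by simp [U]
  have hO : ∀ v, v ∈ O ↔ v ∈ orbit G p := by simp [O]
  have key := Finset.sum_card_bipartiteAbove_eq_sum_card_bipartiteBelow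
    (s := O) (t := U) (fun v g => g • v = v)
  have h1 : ∀ g ∈ U, (O.bipartiteBelow (fun v (g : G) => g • v = v) g).card = 1 := by
    intro g hg
    rw [hU] at hg
    rw [← hg.2, ← Set.ncard_coe_finset]
    congr 1
    ext v
    simp only [Finset.bipartiteBelow, Finset.coe_filter, hO, Set.mem_ofPred_eq, mem_fixedBy]
    exact ⟨fun h => h.2, fun h => ⟨hone g hg.1 hg.2 h, h⟩⟩
  have h2 : ∀ v ∈ O, (U.bipartiteAbove (fun v (g : G) => g • v = v) v).card =
      Nat.card Q - 1 := by
    intro v hv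
    obtain ⟨a, rfl⟩ := (hO v).1 hv
    have hQ1 : Nat.card Q - 1 = ((Q : Set G) \ {1}).ncard := by
      have := Set.ncard_sdiff_singleton_add_one (one_mem Q) (Set.toFinite (Q : Set G))
      have h' : (Q : Set G).ncard = Nat.card Q := rfl
      omega
    rw [hQ1, ← Set.ncard_coe_finset]
    symm
    refine Set.ncard_congr (fun g _ => a * g * a⁻¹) ?_ ?_ ?_
    · rintro g ⟨hg, hg1⟩
      have hg1' : g ≠ 1 := hg1
      rcases (hQ g).1 hg with h | h
      · exact absurd h hg1'
      · simp only [Finset.bipartiteAbove, Finset.coe_filter, Set.mem_ofPred_eq, hU]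
        refine ⟨⟨by simpa using hg1', ?_⟩, by simp [mul_smul, h.1]⟩
        rw [← h.2, ← smul_fixedBy]
        exact Set.ncard_smul_set a _
    · intro g g' _ _ h
      simpa using h
    · intro g hg
      simp only [Finset.bipartiteAbove, Finset.coe_filter, Set.mem_ofPred_eq, hU] at hg
      refine ⟨a⁻¹ * g * a, ⟨(hQ _).2 (Or.inr ⟨?_, ?_⟩), ?_⟩, by group⟩
      · rw [mul_smul, mul_smul, hg.2, inv_smul_smul]
      · rw [← hg.1.2]
        have := smul_fixedBy Ω g a⁻¹
        rw [inv_inv] at this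
        rw [← this]
        exact Set.ncard_smul_set a⁻¹ _
      · intro h
        refine hg.1.1 ?_
        have h : a⁻¹ * g * a = 1 := h
        rw [mul_assoc, inv_mul_eq_one] at h
        exact (mul_eq_right.1 h.symm)
  rw [Finset.sum_congr rfl h1, Finset.sum_congr rfl h2] at key
  have hUc : {g : G | g ≠ 1 ∧ (fixedBy Ω g).ncard = 1}.ncard = U.card := by
    rw [← Set.ncard_coe_finset]; simp [U]
  have hOc : (orbit G p).ncard = O.card := by rw [← Set.ncard_coe_finset]; simp [O]
  rw [hUc, hOc]
  simpa using key.symm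

/-- Orders of point stabilizers in a finite group all of whose nontrivial elements have one or
two fixed points. The set `B` separates the orbits of `p` and `r`. -/
theorem card_stabilizers_of_two_fixed_points [Finite G] [Finite Ω] {B : Set Ω}
    (hB : ∀ (g : G), ∀ w ∈ B, g • w ∈ B)
    (hfix : ∀ g : G, g ≠ 1 → (fixedBy Ω g).ncard = 1 ∨ (fixedBy Ω g).ncard = 2)
    (hone : ∀ g : G, g ≠ 1 → (fixedBy Ω g).ncard = 1 → fixedBy Ω g ⊆ B)
    {p p' r r' : Ω} (hpp : p' ≠ p) (hrr : r' ≠ r) (hp : p ∈ B) (hp' : p' ∈ B)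
    (hr : r ∉ B) (hr' : r' ∉ B)
    (np : 4 ≤ Nat.card (stabilizer G p)) (np' : 2 ≤ Nat.card (stabilizer G p'))
    (nr : 4 ≤ Nat.card (stabilizer G r)) (nr' : 2 ≤ Nat.card (stabilizer G r'))
    (Q : Subgroup G) (hQ : ∀ g, g ∈ Q ↔ g = 1 ∨ (g • p = p ∧ (fixedBy Ω g).ncard = 1))
    {k : ℕ} (hk : Nat.card (stabilizer G p) = Nat.card Q * k) (h4 : 4 ≤ k)
    (hkQ : Nat.card Q ≠ 1 → k + 1 ≤ Nat.card Q) :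
    (k + 1 = Nat.card Q ∧ Nat.card (stabilizer G r) = Nat.card Q + 1) ∨
      (2 * k + 1 = Nat.card Q ∧ 2 * Nat.card (stabilizer G r) = Nat.card Q + 1) := by
  have hsub : ∀ {v w : Ω}, v ∈ B → w ∈ orbit G v → w ∈ B := by
    rintro v w hv ⟨g, rfl⟩
    exact hB g v hv
  have hpr : ∀ {v w : Ω}, v ∈ B → w ∉ B → w ∉ orbit G v := fun hv hw h => hw (hsub hv h)
  have hrp : ∀ {v w : Ω}, v ∈ B → w ∉ B → v ∉ orbit G w := fun hv hw h =>
    hw (hsub hv (mem_orbit_symm.1 h))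
  have hp'o : p' ∈ orbit G p :=
    (mem_orbit_or_mem_orbit hfix (hpr hp hr) np nr np').resolve_right (hrp hp' hr)
  have hr'o : r' ∈ orbit G r :=
    (mem_orbit_or_mem_orbit hfix (hpr hp hr) np nr nr').resolve_left (hpr hp hr')
  have hone' : ∀ g : G, g ≠ 1 → (fixedBy Ω g).ncard = 1 → fixedBy Ω g ⊆ orbit G p := by
    intro g hg h1 v hv
    have hvB := hone g hg h1 hv
    refine (mem_orbit_or_mem_orbit hfix (hpr hp hr) np nr ?_).resolve_right (hrp hvB hr)
    rw [← ncard_fixing_add_one]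
    have : 0 < {g : G | g ≠ 1 ∧ g • v = v}.ncard :=
      (Set.ncard_pos (Set.toFinite _)).2 ⟨g, hg, hv⟩
    omega
  have hsum := ncard_orbit_add_ncard_orbit hfix (hpr hp hr) np nr
  rw [ncard_unipotent hone' Q hQ] at hsum
  have two : ∀ {v w : Ω}, w ≠ v → w ∈ orbit G v → 2 ≤ (orbit G v).ncard := by
    intro v w h hw
    exact (Set.one_lt_ncard (Set.toFinite _)).2 ⟨w, hw, v, mem_orbit_self v, h⟩
  have tp := two hpp hp'o
  have tr := two hrr hr'o
  have hQ1 : Nat.card Q ≠ 1 := by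
    intro h
    rw [h] at hsum
    omega
  obtain ⟨c, hc⟩ := card_dvd_of_free_off_point (mem_orbit_self p) Q
    (by rintro g _ _ ⟨a, rfl⟩; exact ⟨g * a, mul_smul g a p⟩)
    (fun g hg => by
      rcases (hQ g).1 hg with rfl | h
      · simp
      · exact h.1)
    (fun g hg w _ hwp hgw => by
      rcases (hQ g).1 hg with h | h
      · exact h
      · exfalso
        obtain ⟨z, hz⟩ := Set.ncard_eq_one.1 h.2
        have h1 : w ∈ fixedBy Ω g := hgw
        have h2 : p ∈ fixedBy Ω g := h.1
        rw [hz] at h1 h2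
        exact hwp (h1.trans h2.symm))
  refine orders_of_orbit_equation hc ?_ ?_ (ncard_orbit_mul_natCard_stabilizer r) hsum h4 (hkQ hQ1)
  · rintro rfl
    omega
  · rw [← hk]
    exact ncard_orbit_mul_natCard_stabilizer p

end OrbitCount

/-! ### The action of `PSL(2, F)` on the projective line -/

section ProjectiveLine

open Matrix

variable {F : Type*} [Field F]

theorem SL2.det_eq (A : SL(2, F)) : A 0 0 * A 1 1 - A 0 1 * A 1 0 = 1 := by
  have := A.det_coe
  rwa [Matrix.det_fin_two] at this

theorem SL2.ext' {A B : SL(2, F)} (h00 : A 0 0 = B 0 0) (h01 : A 0 1 = B 0 1)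
    (h10 : A 1 0 = B 1 0) (h11 : A 1 1 = B 1 1) : A = B := by
  ext i j
  fin_cases i <;> fin_cases j <;> assumption

theorem SL2.mul_apply_00 (A B : SL(2, F)) :
    (A * B) 0 0 = A 0 0 * B 0 0 + A 0 1 * B 1 0 := by
  simp [Matrix.mul_apply, Fin.sum_univ_two]

theorem SL2.mul_apply_01 (A B : SL(2, F)) :
    (A * B) 0 1 = A 0 0 * B 0 1 + A 0 1 * B 1 1 := by
  simp [Matrix.mul_apply, Fin.sum_univ_two]

theorem SL2.mul_apply_10 (A B : SL(2, F)) :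
    (A * B) 1 0 = A 1 0 * B 0 0 + A 1 1 * B 1 0 := by
  simp [Matrix.mul_apply, Fin.sum_univ_two]

theorem SL2.mul_apply_11 (A B : SL(2, F)) :
    (A * B) 1 1 = A 1 0 * B 0 1 + A 1 1 * B 1 1 := by
  simp [Matrix.mul_apply, Fin.sum_univ_two]

theorem SL2.one_00 : (1 : SL(2, F)) 0 0 = 1 := by simp
theorem SL2.one_01 : (1 : SL(2, F)) 0 1 = 0 := by simp
theorem SL2.one_10 : (1 : SL(2, F)) 1 0 = 0 := by simp
theorem SL2.one_11 : (1 : SL(2, F)) 1 1 = 1 := by simp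

theorem SL2.neg_apply (A : SL(2, F)) (i j : Fin 2) : (-A) i j = -(A i j) := by
  simp [Matrix.SpecialLinearGroup.coe_neg]

/-- The matrix with rows `(a, b)` and `(c, d)`, as an element of `SL(2, F)`. -/
def SL2.of (a b c d : F) (h : a * d - b * c = 1) : SL(2, F) :=
  ⟨!![a, b; c, d], by rw [Matrix.det_fin_two_of, h]⟩

section
variable (a b c d : F) (h : a * d - b * c = 1)
@[simp] theorem SL2.of_00 : SL2.of a b c d h 0 0 = a := rfl
@[simp] theorem SL2.of_01 : SL2.of a b c d h 0 1 = b := rfl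
@[simp] theorem SL2.of_10 : SL2.of a b c d h 1 0 = c := rfl
@[simp] theorem SL2.of_11 : SL2.of a b c d h 1 1 = d := rfl
end

theorem SL2.inv_eq_of (A : SL(2, F)) :
    A⁻¹ = SL2.of (A 1 1) (-A 0 1) (-A 1 0) (A 0 0) (by linear_combination SL2.det_eq A) := by
  rw [inv_eq_iff_mul_eq_one]
  apply SL2.ext' <;> simp only [SL2.mul_apply_00, SL2.mul_apply_01, SL2.mul_apply_10,
    SL2.mul_apply_11, SL2.of_00, SL2.of_01, SL2.of_10, SL2.of_11, SL2.one_00, SL2.one_01,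
    SL2.one_10, SL2.one_11]
  · linear_combination SL2.det_eq A
  · ring
  · ring
  · linear_combination SL2.det_eq A

theorem SL2.mem_center_iff (A : SL(2, F)) :
    A ∈ Subgroup.center SL(2, F) ↔ A = 1 ∨ A = -1 := by
  rw [Matrix.SpecialLinearGroup.mem_center_iff]
  constructor
  · rintro ⟨r, hr, h⟩
    have h00 : A 0 0 = r := by rw [← h]; simp [Matrix.scalar_apply]
    have h01 : A 0 1 = 0 := by rw [← h]; simp [Matrix.scalar_apply]
    have h10 : A 1 0 = 0 := by rw [← h]; simp [Matrix.scalar_apply]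
    have h11 : A 1 1 = r := by rw [← h]; simp [Matrix.scalar_apply]
    have hr' : r ^ 2 = 1 := by simpa using hr
    rcases sq_eq_one_iff.1 hr' with rfl | rfl
    · left; apply SL2.ext' <;> simp [*]
    · right; apply SL2.ext' <;> simp [*, SL2.neg_apply]
  · rintro (rfl | rfl)
    · exact ⟨1, by simp, by simp⟩
    · exact ⟨-1, by simp, by ext i j; fin_cases i <;> fin_cases j <;> simp⟩

theorem PSL2.coe_eq_coe {A B : SL(2, F)} : (A : PSL(2, F)) = B ↔ A = B ∨ A = -B := by
  rw [QuotientGroup.eq, SL2.mem_center_iff, inv_mul_eq_one, inv_mul_eq_iff_eq_mul]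
  refine or_congr Iff.rfl ⟨fun h => ?_, fun h => ?_⟩
  · rw [h]; simp
  · rw [h]; simp

theorem PSL2.coe_eq_one {A : SL(2, F)} : (A : PSL(2, F)) = 1 ↔ A = 1 ∨ A = -1 := by
  rw [← QuotientGroup.mk_one, PSL2.coe_eq_coe]


/-- The square of the trace, which is well defined on `PSL(2, F)`. -/
def PSL2.traceSq : PSL(2, F) → F :=
  Quotient.lift (fun A : SL(2, F) => (A 0 0 + A 1 1) ^ 2) (by
    intro A B h
    rcases PSL2.coe_eq_coe.1 (Quotient.sound h) with rfl | rfl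
    · rfl
    · simp only [SL2.neg_apply]; ring)

theorem PSL2.traceSq_coe (A : SL(2, F)) :
    PSL2.traceSq (A : PSL(2, F)) = (A 0 0 + A 1 1) ^ 2 := rfl

variable (K : Type*) [Field K] [Algebra F K]

open scoped Classical in
/-- Möbius transformations: `SL(2, F)` acting on the projective line over an extension `K`. -/
noncomputable def SL2.moebius : SL(2, F) →* Equiv.Perm (OnePoint K) :=
  (MulAction.toPermHom (GL (Fin 2) K) (OnePoint K)).comp
    (Matrix.SpecialLinearGroup.toGL.comp (Matrix.SpecialLinearGroup.map (algebraMap F K)))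

open scoped Classical in
theorem SL2.moebius_infty (A : SL(2, F)) :
    SL2.moebius K A OnePoint.infty = if A 1 0 = 0 then OnePoint.infty else
      ((algebraMap F K (A 0 0 / A 1 0) : K) : OnePoint K) := by
  have : SL2.moebius K A OnePoint.infty = (Matrix.SpecialLinearGroup.toGL
    (Matrix.SpecialLinearGroup.map (algebraMap F K) A)) • (OnePoint.infty : OnePoint K) := rfl
  rw [this, OnePoint.smul_infty_eq_ite]
  simp

open scoped Classical in
theorem SL2.moebius_coe (A : SL(2, F)) (z : K) :
    SL2.moebius K A z = if algebraMap F K (A 1 0) * z + algebraMap F K (A 1 1) = 0 then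
      OnePoint.infty else
      (((algebraMap F K (A 0 0) * z + algebraMap F K (A 0 1)) /
        (algebraMap F K (A 1 0) * z + algebraMap F K (A 1 1)) : K) : OnePoint K) := by
  have : SL2.moebius K A z = (Matrix.SpecialLinearGroup.toGL
    (Matrix.SpecialLinearGroup.map (algebraMap F K) A)) • (z : OnePoint K) := rfl
  rw [this, OnePoint.smul_some_eq_ite]
  simp

theorem SL2.moebius_infty_eq_iff (A : SL(2, F)) :
    SL2.moebius K A OnePoint.infty = OnePoint.infty ↔ A 1 0 = 0 := by
  rw [SL2.moebius_infty]
  split_ifs with h <;> simp [h]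

theorem SL2.moebius_coe_eq_iff (A : SL(2, F)) (z : K) :
    SL2.moebius K A z = z ↔ algebraMap F K (A 1 0) * z ^ 2 +
      (algebraMap F K (A 1 1) - algebraMap F K (A 0 0)) * z - algebraMap F K (A 0 1) = 0 := by
  have hdet := congrArg (algebraMap F K) (SL2.det_eq A)
  simp only [map_sub, map_mul, map_one] at hdet
  rw [SL2.moebius_coe]
  split_ifs with h
  · refine ⟨fun h' => absurd h' (OnePoint.infty_ne_coe _), fun h' => ?_⟩
    exfalso
    have h1 : algebraMap F K (A 0 0) * z + algebraMap F K (A 0 1) = 0 := by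
      linear_combination z * h - h'
    have : (1 : K) = 0 := by
      linear_combination -hdet + algebraMap F K (A 0 0) * h - algebraMap F K (A 1 0) * h1
    exact one_ne_zero this
  · rw [OnePoint.coe_eq_coe, div_eq_iff h]
    constructor <;> intro h' <;> linear_combination -h'

/-- The action of `PSL(2, F)` on the projective line over `K`, as a homomorphism. -/
noncomputable def PSL2.moebius : PSL(2, F) →* Equiv.Perm (OnePoint K) :=
  QuotientGroup.lift _ (SL2.moebius K) (by
    intro A hA
    have hA' : A 1 0 = 0 ∧ A 0 1 = 0 ∧ A 0 0 = A 1 1 := by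
      rcases (SL2.mem_center_iff A).1 hA with rfl | rfl <;> simp [SL2.neg_apply]
    rw [MonoidHom.mem_ker]
    ext w
    induction w using OnePoint.rec with
    | infty => rw [(SL2.moebius_infty_eq_iff K A).2 hA'.1]; rfl
    | coe z =>
      rw [(SL2.moebius_coe_eq_iff K A z).2 (by simp [hA'])]; rfl)

/-- `PSL(2, F)` acts on the projective line over an extension `K` of `F`. -/
noncomputable instance PSL2.instMulActionOnePoint : MulAction PSL(2, F) (OnePoint K) :=
  MulAction.compHom (OnePoint K) (PSL2.moebius K)

theorem PSL2.coe_smul (A : SL(2, F)) (w : OnePoint K) :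
    (A : PSL(2, F)) • w = SL2.moebius K A w := rfl

variable (F) in
/-- The `F`-rational points of the projective line over `K`. -/
def rationalPoints : Set (OnePoint K) := Set.range (OnePoint.map (algebraMap F K))

theorem infty_mem_rationalPoints : OnePoint.infty ∈ rationalPoints F K :=
  ⟨OnePoint.infty, rfl⟩

theorem coe_mem_rationalPoints_iff {z : K} :
    (z : OnePoint K) ∈ rationalPoints F K ↔ z ∈ Set.range (algebraMap F K) := by
  constructor
  · rintro ⟨w, hw⟩
    induction w using OnePoint.rec with
    | infty => exact absurd hw (OnePoint.infty_ne_coe _)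
    | coe a => exact ⟨a, OnePoint.coe_injective hw⟩
  · rintro ⟨a, rfl⟩
    exact ⟨(a : OnePoint F), rfl⟩

theorem smul_mem_rationalPoints (g : PSL(2, F)) {w : OnePoint K} (hw : w ∈ rationalPoints F K) :
    g • w ∈ rationalPoints F K := by
  classical
  obtain ⟨v, rfl⟩ := hw
  obtain ⟨A, rfl⟩ := QuotientGroup.mk_surjective g
  exact ⟨(Matrix.SpecialLinearGroup.toGL A) • v, OnePoint.map_smul (algebraMap F K) _ v⟩

theorem SL2.eq_one_or_neg_one_of_apply_01_10 {A : SL(2, F)} (h01 : A 0 1 = 0) (h10 : A 1 0 = 0)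
    (h : A 0 0 = A 1 1) : A = 1 ∨ A = -1 := by
  have hd := SL2.det_eq A
  have : A 0 0 ^ 2 = 1 := by
    linear_combination hd + A 0 0 * h + A 0 1 * h10
  rcases sq_eq_one_iff.1 this with h1 | h1
  · left; apply SL2.ext' <;> simp [h01, h10, ← h, h1]
  · right; apply SL2.ext' <;> simp [h01, h10, ← h, h1, SL2.neg_apply]

/-- A nontrivial element of square trace `4` has exactly one fixed point, and it is rational;
every other nontrivial element has exactly two fixed points. -/
theorem PSL2.fixedBy_cases (hK : ∀ t : F, ∃ μ : K, μ ^ 2 - algebraMap F K t * μ + 1 = 0)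
    {g : PSL(2, F)} (hg : g ≠ 1) :
    (PSL2.traceSq g = 4 ∧ ∃ w ∈ rationalPoints F K, fixedBy (OnePoint K) g = {w}) ∨
    (PSL2.traceSq g ≠ 4 ∧ ∃ w w', w ≠ w' ∧ fixedBy (OnePoint K) g = {w, w'}) := by
  obtain ⟨A, rfl⟩ := QuotientGroup.mk_surjective g
  have hdet := SL2.det_eq A
  have hinj : Function.Injective (algebraMap F K) := (algebraMap F K).injective
  rw [PSL2.traceSq_coe]
  by_cases hc : A 1 0 = 0
  · rw [hc] at hdet
    by_cases had : A 0 0 = A 1 1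
    · left
      refine ⟨by rw [← had] at hdet ⊢; linear_combination 4 * hdet, OnePoint.infty,
        infty_mem_rationalPoints K, ?_⟩
      ext w
      rw [mem_fixedBy, PSL2.coe_smul, Set.mem_singleton_iff]
      induction w using OnePoint.rec with
      | infty => simp [SL2.moebius_infty_eq_iff, hc]
      | coe z =>
        simp only [SL2.moebius_coe_eq_iff, hc, had, OnePoint.coe_ne_infty, iff_false]
        intro h
        have h01 : A 0 1 = 0 := hinj (by simpa using h)
        exact hg (PSL2.coe_eq_one.2 (SL2.eq_one_or_neg_one_of_apply_01_10 h01 hc had))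
    · right
      have hne : algebraMap F K (A 1 1) - algebraMap F K (A 0 0) ≠ 0 :=
        sub_ne_zero.2 fun h => had (hinj h).symm
      refine ⟨fun h => had ?_, OnePoint.infty, ((algebraMap F K (A 0 1) /
        (algebraMap F K (A 1 1) - algebraMap F K (A 0 0)) : K) : OnePoint K),
        OnePoint.infty_ne_coe _, ?_⟩
      · have : (A 0 0 - A 1 1) ^ 2 = 0 := by linear_combination h - 4 * hdet
        exact sub_eq_zero.1 (pow_eq_zero_iff two_ne_zero |>.1 this)
      · ext w
        rw [mem_fixedBy, PSL2.coe_smul, Set.mem_insert_iff, Set.mem_singleton_iff]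
        induction w using OnePoint.rec with
        | infty => simp [SL2.moebius_infty_eq_iff, hc]
        | coe z =>
          simp only [SL2.moebius_coe_eq_iff, hc, OnePoint.coe_ne_infty, false_or,
            OnePoint.coe_eq_coe, eq_div_iff hne, map_zero]
          constructor <;> intro h <;> linear_combination h
  · obtain ⟨μ, hμ⟩ := hK (A 0 0 + A 1 1)
    have hc' : algebraMap F K (A 1 0) ≠ 0 := fun h => hc (hinj (by simpa using h))
    have hdet' := congrArg (algebraMap F K) hdet
    simp only [map_sub, map_mul, map_one] at hdet'
    rw [map_add] at hμ
    set a := algebraMap F K (A 0 0)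
    set b := algebraMap F K (A 0 1)
    set c := algebraMap F K (A 1 0)
    set d := algebraMap F K (A 1 1)
    have hfix : fixedBy (OnePoint K) (A : PSL(2, F)) =
        {(((μ - d) / c : K) : OnePoint K), (((a - μ) / c : K) : OnePoint K)} := by
      ext w
      rw [mem_fixedBy, PSL2.coe_smul, Set.mem_insert_iff, Set.mem_singleton_iff]
      induction w using OnePoint.rec with
      | infty => simp [SL2.moebius_infty_eq_iff, hc]
      | coe z =>
        rw [SL2.moebius_coe_eq_iff, OnePoint.coe_eq_coe, OnePoint.coe_eq_coe, eq_div_iff hc',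
          eq_div_iff hc', ← sub_eq_zero (a := z * c), ← sub_eq_zero (a := z * c),
          ← mul_eq_zero, ← mul_right_inj' hc', mul_zero]
        have : c * (c * z ^ 2 + (d - a) * z - b) =
            (z * c - (μ - d)) * (z * c - (a - μ)) := by
          linear_combination hdet' + hμ
        rw [← this]
    have hiff : (A 0 0 + A 1 1) ^ 2 = 4 ↔ μ - d = a - μ := by
      rw [← hinj.eq_iff, ← sub_eq_zero (a := μ - d)]
      simp only [map_pow, map_add, map_ofNat]
      rw [← pow_eq_zero_iff two_ne_zero, ← sub_eq_zero]
      have : (μ - d - (a - μ)) ^ 2 = (a + d) ^ 2 - 4 := by linear_combination 4 * hμ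
      rw [this]
    by_cases h4 : (A 0 0 + A 1 1) ^ 2 = 4
    · left
      have h := hiff.1 h4
      refine ⟨h4, _, ?_, by rw [hfix, ← h, Set.pair_eq_singleton]⟩
      rw [coe_mem_rationalPoints_iff]
      have h1 : μ ^ 2 = 1 := by linear_combination -hμ + μ * h
      rcases sq_eq_one_iff.1 h1 with rfl | rfl
      · exact ⟨(1 - A 1 1) / A 1 0, by simp [c, d]⟩
      · exact ⟨(-1 - A 1 1) / A 1 0, by simp [c, d]⟩
    · right
      refine ⟨h4, _, _, fun h => h4 (hiff.2 ?_), hfix⟩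
      rw [OnePoint.coe_eq_coe] at h
      exact (div_left_inj' hc').1 h

end ProjectiveLine

/-! ### Stabilizers in subgroups of `PSL(2, F)` -/

section SubfieldSubgroups

open Matrix

universe u

theorem exists_finite_extension_splitting (F : Type u) [Field F] [Finite F] :
    ∃ (K : Type u) (_ : Field K) (_ : Algebra F K), Finite K ∧
      ∀ t : F, ∃ μ : K, μ ^ 2 - algebraMap F K t * μ + 1 = 0 := by
  classical
  have := Fintype.ofFinite F
  let P : F → Polynomial F := fun t =>
    Polynomial.C 1 * Polynomial.X ^ 2 + Polynomial.C (-t) * Polynomial.X + Polynomial.C 1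
  have hdeg : ∀ t, (P t).degree = 2 := fun t => Polynomial.degree_quadratic one_ne_zero
  have hne : ∀ t, P t ≠ 0 := fun t h => by simpa [h] using hdeg t
  let Q : Polynomial F := ∏ t, P t
  refine ⟨Q.SplittingField, inferInstance, inferInstance, Module.finite_of_finite F, fun t => ?_⟩
  have hs := Polynomial.SplittingField.splits Q
  rw [Polynomial.map_prod, Polynomial.splits_prod_iff] at hs
  · obtain ⟨μ, hμ⟩ := (hs t (Finset.mem_univ t)).exists_eval_eq_zero (by
      rw [Polynomial.degree_map, hdeg]; decide)
    refine ⟨μ, ?_⟩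
    rw [Polynomial.eval_map] at hμ
    simp only [P, Polynomial.eval₂_add, Polynomial.eval₂_mul, Polynomial.eval₂_C,
      Polynomial.eval₂_pow, Polynomial.eval₂_X] at hμ
    rw [map_one, map_neg] at hμ
    linear_combination hμ
  · intro t _
    exact Polynomial.map_ne_zero (hne t)

variable {F : Type u} [Field F]

/-- The diagonal matrix with eigenvalues `l`, `l⁻¹`. -/
def SL2.diag (l : F) (h : l ≠ 0) : SL(2, F) :=
  SL2.of l 0 0 l⁻¹ (by rw [mul_inv_cancel₀ h]; ring)

/-- The upper unitriangular matrix with entry `b`. -/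
def SL2.unip (b : F) : SL(2, F) := SL2.of 1 b 0 1 (by ring)

theorem SL2.unip_add (b c : F) : SL2.unip (b + c) = SL2.unip b * SL2.unip c := by
  apply SL2.ext' <;> simp only [SL2.unip, SL2.mul_apply_00, SL2.mul_apply_01, SL2.mul_apply_10,
    SL2.mul_apply_11, SL2.of_00, SL2.of_01, SL2.of_10, SL2.of_11] <;> ring

theorem SL2.unip_zero : SL2.unip (0 : F) = 1 := by
  apply SL2.ext' <;> simp [SL2.unip]

theorem SL2.unip_neg (b : F) : SL2.unip (-b) = (SL2.unip b)⁻¹ := by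
  rw [eq_inv_iff_mul_eq_one, ← SL2.unip_add, neg_add_cancel, SL2.unip_zero]

theorem PSL2.unip_injective :
    Function.Injective (fun b : F => (SL2.unip b : PSL(2, F))) := by
  intro b c h
  rcases PSL2.coe_eq_coe.1 h with h | h
  · exact congrArg (fun A : SL(2, F) => A 0 1) h
  · have h0 := congrArg (fun A : SL(2, F) => A 0 0) h
    have h1 := congrArg (fun A : SL(2, F) => A 0 1) h
    simp only [SL2.unip, SL2.neg_apply, SL2.of_00, SL2.of_01] at h0 h1
    linear_combination h1 - c * h0

theorem SL2.conj_unip {A : SL(2, F)} (h : A 1 0 = 0) (b : F) :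
    A * SL2.unip b * A⁻¹ = SL2.unip (A 0 0 ^ 2 * b) := by
  have hd := SL2.det_eq A
  rw [SL2.inv_eq_of]
  apply SL2.ext' <;> simp only [SL2.unip, SL2.mul_apply_00, SL2.mul_apply_01, SL2.mul_apply_10,
    SL2.mul_apply_11, SL2.of_00, SL2.of_01, SL2.of_10, SL2.of_11, h] <;> rw [h] at hd
  · linear_combination hd
  · ring
  · ring
  · linear_combination hd

/-- The full unipotent group together with one element moving its fixed point generates. -/
theorem PSL2.eq_top_of_unip_mem {H : Subgroup PSL(2, F)}
    (hU : ∀ b : F, (SL2.unip b : PSL(2, F)) ∈ H) {B : SL(2, F)} (hB : (B : PSL(2, F)) ∈ H)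
    (hc : B 1 0 ≠ 0) : H = ⊤ := by
  have hdB := SL2.det_eq B
  set N : Subgroup SL(2, F) := H.comap (QuotientGroup.mk' _)
  have hN : ∀ A : SL(2, F), A ∈ N ↔ (A : PSL(2, F)) ∈ H := fun A => Iff.rfl
  set W : SL(2, F) := SL2.of 0 (-(B 1 0)⁻¹) (B 1 0) 0 (by field_simp; ring)
  have hW : W ∈ N := by
    have : W = SL2.unip (-(B 0 0 / B 1 0)) * B * SL2.unip (-(B 1 1 / B 1 0)) := by
      apply SL2.ext' <;> simp only [W, SL2.unip, SL2.mul_apply_00, SL2.mul_apply_01,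
        SL2.mul_apply_10, SL2.mul_apply_11, SL2.of_00, SL2.of_01, SL2.of_10, SL2.of_11] <;>
        field_simp
      · ring
      · linear_combination hdB
      · ring
      · ring
    rw [this]
    exact mul_mem (mul_mem ((hN _).2 (hU _)) ((hN _).2 hB)) ((hN _).2 (hU _))
  have hL : ∀ b : F, SL2.of 1 0 b 1 (by ring) ∈ N := by
    intro b
    have : SL2.of 1 0 b 1 (by ring) = W * SL2.unip (-(b / (B 1 0) ^ 2)) * W⁻¹ := by
      rw [SL2.inv_eq_of]
      apply SL2.ext' <;> simp only [W, SL2.unip, SL2.mul_apply_00, SL2.mul_apply_01,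
        SL2.mul_apply_10, SL2.mul_apply_11, SL2.of_00, SL2.of_01, SL2.of_10, SL2.of_11] <;>
        field_simp <;> ring
    rw [this]
    exact mul_mem (mul_mem hW ((hN _).2 (hU _))) (inv_mem hW)
  have hall : ∀ A : SL(2, F), A ∈ N := by
    intro A
    refine Matrix.SL2.transvection_induction (fun A => A ∈ N) ?_ (fun A B hA hB => mul_mem hA hB) A
    intro i j hij c
    by_cases hi : i = 0
    · subst hi
      obtain rfl : j = 1 := by fin_cases j <;> simp_all
      have : Matrix.SpecialLinearGroup.transvection hij c = SL2.unip c := by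
        apply SL2.ext' <;>
          simp [SL2.unip, Matrix.SpecialLinearGroup.transvection, Matrix.transvection]
      rw [this]
      exact (hN _).2 (hU c)
    · obtain rfl : i = 1 := by fin_cases i <;> simp_all
      obtain rfl : j = 0 := by fin_cases j <;> simp_all
      have : Matrix.SpecialLinearGroup.transvection hij c = SL2.of 1 0 c 1 (by ring) := by
        apply SL2.ext' <;>
          simp [Matrix.SpecialLinearGroup.transvection, Matrix.transvection]
      rw [this]
      exact hL c
  rw [eq_top_iff]
  intro g _
  obtain ⟨A, rfl⟩ := QuotientGroup.mk_surjective g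
  exact (hN A).1 (hall A)

/-- The elements `b` whose unitriangular matrix lies in `H`. -/
def PSL2.unipGroup (H : Subgroup PSL(2, F)) : AddSubgroup F where
  carrier := {b | (SL2.unip b : PSL(2, F)) ∈ H}
  zero_mem' := by
    change (SL2.unip (0 : F) : PSL(2, F)) ∈ H
    rw [SL2.unip_zero]; exact one_mem H
  add_mem' := by
    intro b c hb hc
    change (SL2.unip (b + c) : PSL(2, F)) ∈ H
    rw [SL2.unip_add]; exact H.mul_mem hb hc
  neg_mem' := by
    intro b hb
    change (SL2.unip (-b) : PSL(2, F)) ∈ H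
    rw [SL2.unip_neg]; exact H.inv_mem hb

theorem PSL2.mem_unipGroup {H : Subgroup PSL(2, F)} {b : F} :
    b ∈ PSL2.unipGroup H ↔ (SL2.unip b : PSL(2, F)) ∈ H := Iff.rfl

/-- The square of the upper left entry, which is well defined on `PSL(2, F)`. It is multiplicative
on the stabilizer of `∞` only. -/
def PSL2.multiplier : PSL(2, F) → F :=
  Quotient.lift (fun A : SL(2, F) => A 0 0 ^ 2) (by
    intro A B h
    rcases PSL2.coe_eq_coe.1 (Quotient.sound h) with rfl | rfl
    · rfl
    · simp only [SL2.neg_apply]; ring)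

theorem PSL2.multiplier_coe (A : SL(2, F)) :
    PSL2.multiplier (A : PSL(2, F)) = A 0 0 ^ 2 := rfl

theorem PSL2.smul_infty_eq_iff (K : Type*) [Field K] [Algebra F K] (A : SL(2, F)) :
    (A : PSL(2, F)) • (OnePoint.infty : OnePoint K) = OnePoint.infty ↔ A 1 0 = 0 :=
  SL2.moebius_infty_eq_iff K A

/-- An element of the stabilizer of `∞` acts on the affine line by `z ↦ χ z + c`; this is the
homomorphism `χ`. -/
noncomputable def PSL2.multiplierHom (K : Type*) [Field K] [Algebra F K] (H : Subgroup PSL(2, F)) :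
    stabilizer H (OnePoint.infty : OnePoint K) →* Fˣ :=
  MonoidHom.toHomUnits
    { toFun := fun g => PSL2.multiplier (g : PSL(2, F))
      map_one' := by
        change PSL2.multiplier ((1 : SL(2, F)) : PSL(2, F)) = 1
        rw [PSL2.multiplier_coe, SL2.one_00, one_pow]
      map_mul' := by
        rintro ⟨⟨g, hg⟩, hg'⟩ ⟨⟨h, hh⟩, hh'⟩
        obtain ⟨A, rfl⟩ := QuotientGroup.mk_surjective g
        obtain ⟨B, rfl⟩ := QuotientGroup.mk_surjective h
        have h10 : B 1 0 = 0 := (PSL2.smul_infty_eq_iff K B).1 hh'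
        change PSL2.multiplier ((A * B : SL(2, F)) : PSL(2, F)) =
          PSL2.multiplier (A : PSL(2, F)) * PSL2.multiplier (B : PSL(2, F))
        simp only [PSL2.multiplier_coe, SL2.mul_apply_00, h10]
        ring }

theorem PSL2.multiplierHom_apply (K : Type*) [Field K] [Algebra F K] (H : Subgroup PSL(2, F))
    (g : stabilizer H (OnePoint.infty : OnePoint K)) :
    (PSL2.multiplierHom K H g : F) = PSL2.multiplier (g : PSL(2, F)) := rfl

/-- For an upper triangular `A`, having multiplier `1` means being unitriangular up to sign. -/
theorem PSL2.coe_eq_unip_iff {A : SL(2, F)} (h : A 1 0 = 0) :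
    A 0 0 ^ 2 = 1 ↔ ∃ b : F, (A : PSL(2, F)) = (SL2.unip b : SL(2, F)) := by
  have hd := SL2.det_eq A
  constructor
  · intro h1
    rcases sq_eq_one_iff.1 h1 with h0 | h0 <;> rw [h, h0] at hd
    · refine ⟨A 0 1, congrArg _ (SL2.ext' ?_ ?_ ?_ ?_)⟩ <;> simp only [SL2.unip, SL2.of_00,
        SL2.of_01, SL2.of_10, SL2.of_11, h, h0]
      linear_combination hd
    · refine ⟨-A 0 1, PSL2.coe_eq_coe.2 (Or.inr (SL2.ext' ?_ ?_ ?_ ?_))⟩ <;>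
        simp only [SL2.unip, SL2.neg_apply, SL2.of_00,
        SL2.of_01, SL2.of_10, SL2.of_11, h, h0]
      · ring
      · ring
      · linear_combination -hd
  · rintro ⟨b, hb⟩
    have := congrArg PSL2.multiplier hb
    rw [PSL2.multiplier_coe, PSL2.multiplier_coe] at this
    rw [this]; simp [SL2.unip]


section Stabilizer

variable (K : Type*) [Field K] [Algebra F K] (H : Subgroup PSL(2, F))

theorem PSL2.mem_ker_multiplierHom_iff (g : stabilizer H (OnePoint.infty : OnePoint K)) :
    g ∈ (PSL2.multiplierHom K H).ker ↔ ∃ b : F, (g : PSL(2, F)) = (SL2.unip b : SL(2, F)) := by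
  obtain ⟨⟨g, hg⟩, hg'⟩ := g
  obtain ⟨A, rfl⟩ := QuotientGroup.mk_surjective g
  have h10 : A 1 0 = 0 := (PSL2.smul_infty_eq_iff K A).1 hg'
  rw [MonoidHom.mem_ker, Units.ext_iff, PSL2.multiplierHom_apply]
  exact PSL2.coe_eq_unip_iff h10

theorem PSL2.card_ker_multiplierHom :
    Nat.card (PSL2.multiplierHom K H).ker = Nat.card (PSL2.unipGroup H) := by
  let f : (PSL2.multiplierHom K H).ker → PSL(2, F) := fun g => (g : PSL(2, F))
  have hf : Function.Injective f := fun a b h => Subtype.ext (Subtype.ext (Subtype.ext h))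
  have h1 : Set.range f = (fun b : F => (SL2.unip b : PSL(2, F))) '' (PSL2.unipGroup H) := by
    ext g
    constructor
    · rintro ⟨x, rfl⟩
      obtain ⟨b, hb⟩ := (PSL2.mem_ker_multiplierHom_iff K H x).1 x.2
      refine ⟨b, ?_, hb.symm⟩
      change (SL2.unip b : PSL(2, F)) ∈ H
      rw [← hb]
      exact x.1.1.2
    · rintro ⟨b, hb, rfl⟩
      let y : stabilizer H (OnePoint.infty : OnePoint K) :=
        ⟨⟨(SL2.unip b : PSL(2, F)), hb⟩, (PSL2.smul_infty_eq_iff K _).2 rfl⟩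
      exact ⟨⟨y, (PSL2.mem_ker_multiplierHom_iff K H y).2 ⟨b, rfl⟩⟩, rfl⟩
  rw [← Nat.card_range_of_injective hf, h1, Nat.card_coe_set_eq,
    Set.ncard_image_of_injective _ PSL2.unip_injective]
  rfl

theorem PSL2.card_stabilizer_infty :
    Nat.card (stabilizer H (OnePoint.infty : OnePoint K)) =
      Nat.card (PSL2.unipGroup H) * Nat.card (PSL2.multiplierHom K H).range := by
  rw [← PSL2.card_ker_multiplierHom K H, ← Subgroup.index_ker, Subgroup.card_mul_index]

/-- The unipotent elements of `H` fixing `∞`, as a subgroup of `H`. -/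
noncomputable def PSL2.unipSubgroup : Subgroup H :=
  (PSL2.multiplierHom K H).ker.map (stabilizer H (OnePoint.infty : OnePoint K)).subtype

theorem PSL2.card_unipSubgroup :
    Nat.card (PSL2.unipSubgroup K H) = Nat.card (PSL2.unipGroup H) := by
  rw [PSL2.unipSubgroup, Subgroup.card_map_of_injective (Subgroup.subtype_injective _),
    PSL2.card_ker_multiplierHom]

theorem PSL2.mem_unipSubgroup_iff (g : H) :
    g ∈ PSL2.unipSubgroup K H ↔ ∃ b : F, (g : PSL(2, F)) = (SL2.unip b : SL(2, F)) := by
  constructor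
  · rintro ⟨x, hx, rfl⟩
    exact (PSL2.mem_ker_multiplierHom_iff K H x).1 hx
  · rintro ⟨b, hb⟩
    let y : stabilizer H (OnePoint.infty : OnePoint K) :=
      ⟨g, by
        change (g : PSL(2, F)) • (OnePoint.infty : OnePoint K) = OnePoint.infty
        rw [hb]
        exact (PSL2.smul_infty_eq_iff K _).2 rfl⟩
    exact ⟨y, (PSL2.mem_ker_multiplierHom_iff K H y).2 ⟨b, hb⟩, rfl⟩

variable {K} in
theorem PSL2.ncard_fixedBy_eq_one_iff
    (hK : ∀ t : F, ∃ μ : K, μ ^ 2 - algebraMap F K t * μ + 1 = 0)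
    {g : PSL(2, F)} (hg : g ≠ 1) :
    (fixedBy (OnePoint K) g).ncard = 1 ↔ PSL2.traceSq g = 4 := by
  rcases PSL2.fixedBy_cases K hK hg with ⟨h, w, -, hw⟩ | ⟨h, w, w', hne, hw⟩
  · simp [h, hw]
  · simp [h, hw, Set.ncard_pair hne]

/-- An upper triangular element is unitriangular up to sign if and only if its square trace
is `4`. -/
theorem PSL2.traceSq_eq_four_iff_of_upper {A : SL(2, F)} (h : A 1 0 = 0) :
    PSL2.traceSq (A : PSL(2, F)) = 4 ↔ ∃ b : F, (A : PSL(2, F)) = (SL2.unip b : SL(2, F)) := by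
  have hd := SL2.det_eq A
  rw [← PSL2.coe_eq_unip_iff h, PSL2.traceSq_coe]
  constructor
  · intro h4
    have : (A 0 0 - A 1 1) ^ 2 = 0 := by linear_combination h4 - 4 * hd - 4 * A 0 1 * h
    have := sub_eq_zero.1 ((pow_eq_zero_iff two_ne_zero).1 this)
    linear_combination hd + A 0 0 * this + A 0 1 * h
  · intro h1
    have : A 0 0 = A 1 1 := by
      linear_combination -A 0 0 * hd + A 1 1 * h1 - A 0 0 * A 0 1 * h
    rw [← this]
    linear_combination 4 * h1

theorem PSL2.multiplier_mul_mem {m : Fˣ} (hm : m ∈ (PSL2.multiplierHom K H).range) {b : F}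
    (hb : b ∈ PSL2.unipGroup H) : (m : F) * b ∈ PSL2.unipGroup H := by
  obtain ⟨⟨⟨g, hg⟩, hg'⟩, rfl⟩ := hm
  obtain ⟨A, rfl⟩ := QuotientGroup.mk_surjective g
  have h10 : A 1 0 = 0 := (PSL2.smul_infty_eq_iff K A).1 hg'
  rw [PSL2.multiplierHom_apply]
  change A 0 0 ^ 2 * b ∈ PSL2.unipGroup H
  rw [PSL2.mem_unipGroup, ← SL2.conj_unip h10]
  exact H.mul_mem (H.mul_mem hg hb) (H.inv_mem hg)

theorem PSL2.card_multiplierHom_range_lt [Finite F] (h : Nat.card (PSL2.unipGroup H) ≠ 1) :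
    Nat.card (PSL2.multiplierHom K H).range + 1 ≤ Nat.card (PSL2.unipGroup H) := by
  obtain ⟨b, hb, hb0⟩ : ∃ b ∈ PSL2.unipGroup H, b ≠ 0 := by
    by_contra! h0
    refine h ?_
    rw [(AddSubgroup.eq_bot_iff_forall _).2 h0]
    simp
  have hc : (PSL2.unipGroup H : Set F).ncard = Nat.card (PSL2.unipGroup H) := rfl
  rw [← hc, ← Set.ncard_sdiff_singleton_add_one (zero_mem (PSL2.unipGroup H)) (Set.toFinite _),
    add_le_add_iff_right, ← Nat.card_coe_set_eq]
  refine Nat.card_le_card_of_injective (fun m => ⟨(m : Fˣ) * b, ?_, ?_⟩) ?_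
  · exact PSL2.multiplier_mul_mem K H m.2 hb
  · have hm : ((m : Fˣ) : F) * b ≠ 0 := mul_ne_zero (Units.ne_zero _) hb0
    exact hm
  · intro m m' hmm
    have := congrArg Subtype.val hmm
    exact Subtype.ext (Units.ext (mul_right_cancel₀ hb0 this))

end Stabilizer

end SubfieldSubgroups

/-! ### Subgroups containing a split and a nonsplit element -/

section SubfieldTheorem

universe u

variable {F : Type u} [Field F]

/-- The elements of a finite field that multiply a given additive subgroup into itself. -/
def AddSubgroup.multiplierSubfield [Finite F] (Q : AddSubgroup F) : Subfield F where
  carrier := {r | ∀ b ∈ Q, r * b ∈ Q}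
  mul_mem' := by
    intro r s hr hs b hb
    rw [mul_assoc]
    exact hr _ (hs _ hb)
  one_mem' := by intro b hb; rwa [one_mul]
  add_mem' := by
    intro r s hr hs b hb
    rw [add_mul]
    exact Q.add_mem (hr _ hb) (hs _ hb)
  zero_mem' := by intro b _; rw [zero_mul]; exact Q.zero_mem
  neg_mem' := by
    intro r hr b hb
    rw [neg_mul]
    exact Q.neg_mem (hr _ hb)
  inv_mem' := by
    intro r hr b hb
    rcases eq_or_ne r 0 with rfl | h0
    · rw [inv_zero, zero_mul]; exact Q.zero_mem
    -- multiplication by `r` is injective on the finite set `Q`, hence surjective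
    have hsurj : Function.Surjective (fun c : Q => (⟨r * c, hr _ c.2⟩ : Q)) := by
      refine Finite.surjective_of_injective fun c d h => Subtype.ext ?_
      exact mul_left_cancel₀ h0 (congrArg Subtype.val h)
    obtain ⟨c, hc⟩ := hsurj ⟨b, hb⟩
    have : b = r * c := (congrArg Subtype.val hc).symm
    rw [this, inv_mul_cancel_left₀ h0]
    exact c.2

theorem AddSubgroup.exists_card_eq_pow_card_multiplierSubfield [Finite F] (Q : AddSubgroup F) :
    ∃ d, Nat.card Q = Nat.card Q.multiplierSubfield ^ d := by
  let V : Submodule Q.multiplierSubfield F :=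
    { Q with smul_mem' := fun r b hb => r.2 b hb }
  exact ⟨_, Module.natCard_eq_pow_finrank (K := Q.multiplierSubfield) (V := V)⟩

theorem AddSubgroup.card_eq_card_multiplierSubfield [Finite F] (Q : AddSubgroup F)
    (h1 : Nat.card Q ≠ 1) {k : ℕ} (hk : k + 1 ≤ Nat.card Q.multiplierSubfield)
    (hQ : Nat.card Q ≤ 2 * k + 1) : Nat.card Q = Nat.card Q.multiplierSubfield := by
  obtain ⟨d, hd⟩ := Q.exists_card_eq_pow_card_multiplierSubfield
  have hE : 1 < Nat.card Q.multiplierSubfield := Finite.one_lt_card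
  rcases d with _ | _ | d
  · exact absurd hd h1
  · simpa using hd
  · exfalso
    have : Nat.card Q.multiplierSubfield ^ 2 ≤ Nat.card Q.multiplierSubfield ^ (d + 2) :=
      Nat.pow_le_pow_right (by omega) (by omega)
    nlinarith

/-- A subfield of a finite field is everything or has order at most the square root. -/
theorem Subfield.card_sq_le_or_eq_top [Finite F] (E : Subfield F) :
    Nat.card E ^ 2 ≤ Nat.card F ∨ Nat.card E = Nat.card F := by
  have h := Module.natCard_eq_pow_finrank (K := E) (V := F)
  have hE : 1 < Nat.card E := Finite.one_lt_card
  have hpos : 0 < Module.finrank E F := Module.finrank_pos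
  rcases Nat.lt_or_ge (Module.finrank E F) 2 with h2 | h2
  · right
    rw [h, show Module.finrank E F = 1 by omega, pow_one]
  · left
    rw [h]
    exact Nat.pow_le_pow_right (by omega) h2

theorem Subfield.exists_card_eq_ringChar_pow [Finite F] (E : Subfield F) :
    ∃ j, Nat.card E = ringChar F ^ j := by
  have := Fintype.ofFinite F
  obtain ⟨n, hp, hn⟩ := FiniteField.card F (ringChar F)
  have h := Module.natCard_eq_pow_finrank (K := E) (V := F)
  have hpos : Module.finrank E F ≠ 0 := Module.finrank_pos.ne'
  have hdvd : Nat.card E ∣ ringChar F ^ (n : ℕ) := by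
    rw [← hn, ← Nat.card_eq_fintype_card, h]
    exact dvd_pow_self _ hpos
  obtain ⟨j, -, hj⟩ := (Nat.dvd_prime_pow hp).1 hdvd
  exact ⟨j, hj⟩

/-- A rational fixed point yields a rational eigenvalue. -/
theorem SL2.exists_eigenvalue_of_fixed (K : Type*) [Field K] [Algebra F K] {A : SL(2, F)}
    {w : OnePoint K} (hw : w ∈ rationalPoints F K) (h : (A : PSL(2, F)) • w = w) :
    ∃ μ : F, μ ^ 2 - (A 0 0 + A 1 1) * μ + 1 = 0 := by
  have hd := SL2.det_eq A
  obtain ⟨v, rfl⟩ := hw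
  induction v using OnePoint.rec with
  | infty =>
    have h10 : A 1 0 = 0 := (PSL2.smul_infty_eq_iff K A).1 h
    exact ⟨A 0 0, by linear_combination -hd - A 0 1 * h10⟩
  | coe z =>
    have h' := (SL2.moebius_coe_eq_iff K A (algebraMap F K z)).1 h
    have h2 : A 1 0 * z ^ 2 + (A 1 1 - A 0 0) * z - A 0 1 = 0 := by
      apply (algebraMap F K).injective
      simpa using h'
    exact ⟨A 1 0 * z + A 1 1, by linear_combination A 1 0 * h2 - hd⟩

theorem SL2.diag_pow (l : F) (hl : l ≠ 0) (n : ℕ) :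
    SL2.diag l hl ^ n = SL2.diag (l ^ n) (pow_ne_zero n hl) := by
  induction n with
  | zero => apply SL2.ext' <;> simp [SL2.diag]
  | succ n ih =>
    rw [pow_succ, ih]
    apply SL2.ext' <;> simp only [SL2.diag, SL2.mul_apply_00, SL2.mul_apply_01,
      SL2.mul_apply_10, SL2.mul_apply_11, SL2.of_00, SL2.of_01, SL2.of_10, SL2.of_11]
    · ring
    · ring
    · ring
    · rw [pow_succ, mul_inv]; ring

theorem PSL2.diag_pow_eq_one_iff (l : F) (hl : l ≠ 0) (n : ℕ) :
    (SL2.diag l hl : PSL(2, F)) ^ n = 1 ↔ (l ^ n) ^ 2 = 1 := by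
  rw [← QuotientGroup.mk_pow, SL2.diag_pow]
  constructor
  · intro h
    have := congrArg PSL2.multiplier h
    rw [PSL2.multiplier_coe, ← QuotientGroup.mk_one, PSL2.multiplier_coe] at this
    simpa [SL2.diag] using this
  · intro h
    refine PSL2.coe_eq_one.2 (SL2.eq_one_or_neg_one_of_apply_01_10 rfl rfl ?_)
    exact eq_inv_of_mul_eq_one_left ((pow_two (l ^ n)).symm.trans h)

theorem natCard_stabilizer_ge_orderOf {G Ω : Type*} [Group G] [Finite G] [MulAction G Ω]
    {g : G} {w : Ω} (h : g • w = w) : orderOf g ≤ Nat.card (stabilizer G w) :=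
  Subgroup.orderOf_le_card _ (Set.toFinite _) h

theorem pow_natCard_stabilizer {G Ω : Type*} [Group G] [MulAction G Ω]
    {g : G} {w : Ω} (h : g • w = w) : g ^ Nat.card (stabilizer G w) = 1 := by
  have := pow_card_eq_one' (x := (⟨g, h⟩ : stabilizer G w))
  exact congrArg Subtype.val this

/-- If a proper subgroup of `PSL(2, F)` contains a diagonal element `x` and an element `y` without
rational eigenvalue, both of order at least `4`, then `x ^ (m - 1) = 1` and `y ^ (m + 1) = 1` for
some power `m` of the characteristic with `m ^ 2 ≤ q`, namely the order of a proper subfield. -/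
theorem PSL2.exists_subfield_card_of_ne_top [Finite F] {H : Subgroup PSL(2, F)} {l : F}
    (hl : l ≠ 0) (hx : (SL2.diag l hl : PSL(2, F)) ∈ H)
    (hx4 : 4 ≤ orderOf (SL2.diag l hl : PSL(2, F))) {B : SL(2, F)} (hy : (B : PSL(2, F)) ∈ H)
    (hirr : ∀ μ : F, μ ^ 2 - (B 0 0 + B 1 1) * μ + 1 ≠ 0)
    (hy4 : 4 ≤ orderOf (B : PSL(2, F))) (hH : H ≠ ⊤) :
    ∃ j, (ringChar F ^ j) ^ 2 ≤ Nat.card F ∧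
      (SL2.diag l hl : PSL(2, F)) ^ (ringChar F ^ j - 1) = 1 ∧
      (B : PSL(2, F)) ^ (ringChar F ^ j + 1) = 1 := by
  obtain ⟨K, _, _, _, hK⟩ := exists_finite_extension_splitting F
  have hfinO : Finite (OnePoint K) := inferInstanceAs (Finite (Option K))
  set x : H := ⟨_, hx⟩ with hxdef
  set y : H := ⟨_, hy⟩ with hydef
  have hxo : 4 ≤ orderOf x := by rwa [← Subgroup.orderOf_coe]
  have hyo : 4 ≤ orderOf y := by rwa [← Subgroup.orderOf_coe]
  have hcoe : ∀ {g : H}, g ≠ 1 → (g : PSL(2, F)) ≠ 1 := fun h h' => h (Subtype.ext h')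
  have hy1 : (B : PSL(2, F)) ≠ 1 := by
    intro h; rw [h, orderOf_one] at hy4; omega
  -- the fixed points of `x` and `y`
  have xinf : x • (OnePoint.infty : OnePoint K) = OnePoint.infty :=
    (PSL2.smul_infty_eq_iff K _).2 rfl
  have xzero : x • ((0 : K) : OnePoint K) = (0 : K) :=
    (SL2.moebius_coe_eq_iff K _ _).2 (by simp [SL2.diag])
  have hyB : ∀ w ∈ rationalPoints F K, (B : PSL(2, F)) • w ≠ w := by
    intro w hw h
    obtain ⟨μ, hμ⟩ := SL2.exists_eigenvalue_of_fixed K hw h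
    exact hirr μ hμ
  obtain ⟨r, r', hrr, hfixy⟩ : ∃ w w', w ≠ w' ∧ fixedBy (OnePoint K) (B : PSL(2, F)) = {w, w'} := by
    rcases PSL2.fixedBy_cases K hK hy1 with ⟨-, w, hw, h⟩ | ⟨-, h⟩
    · refine absurd ?_ (hyB w hw)
      rw [← mem_fixedBy, h]; rfl
    · exact h
  have yr : (B : PSL(2, F)) • r = r := by rw [← mem_fixedBy, hfixy]; simp
  have yr' : (B : PSL(2, F)) • r' = r' := by rw [← mem_fixedBy, hfixy]; simp
  have yr_H : y • r = r := yr
  have yr_H' : y • r' = r' := yr'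
  set χ := PSL2.multiplierHom K H
  set Q := PSL2.unipGroup H
  set k := Nat.card χ.range
  -- the multiplier of `x` has the same order as `x`
  set xs : stabilizer H (OnePoint.infty : OnePoint K) := ⟨x, xinf⟩
  have hχ : ∀ n, (χ xs) ^ n = 1 → (SL2.diag l hl : PSL(2, F)) ^ n = 1 := by
    intro n hn
    rw [PSL2.diag_pow_eq_one_iff, ← pow_mul, mul_comm, pow_mul]
    exact congrArg Units.val hn
  have hk4 : 4 ≤ k := by
    refine le_trans (le_trans hx4 ?_)
      (Subgroup.orderOf_le_card χ.range (Set.toFinite _) ⟨xs, rfl⟩)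
    exact orderOf_le_of_pow_eq_one (orderOf_pos _) (hχ _ (pow_orderOf_eq_one _))
  have hcard := card_stabilizers_of_two_fixed_points (G := H) (Ω := OnePoint K)
    (B := rationalPoints F K) (fun g w hw => smul_mem_rationalPoints K (g : PSL(2, F)) hw)
    (fun g hg => by
      rcases PSL2.fixedBy_cases K hK (hcoe hg) with ⟨-, w, -, h⟩ | ⟨-, w, w', hne, h⟩
      · left
        exact (congrArg Set.ncard h).trans (Set.ncard_singleton w)
      · right
        exact (congrArg Set.ncard h).trans (Set.ncard_pair hne))
    (fun g hg h1 => by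
      rcases PSL2.fixedBy_cases K hK (hcoe hg) with ⟨-, w, hw, h⟩ | ⟨h, -⟩
      · have h' : fixedBy (OnePoint K) g = {w} := h
        rw [h']
        exact Set.singleton_subset_iff.2 hw
      · exact absurd ((PSL2.ncard_fixedBy_eq_one_iff hK (hcoe hg)).1 h1) h)
    (p := OnePoint.infty) (p' := ((0 : K) : OnePoint K)) (r := r) (r' := r')
    (OnePoint.coe_ne_infty _) hrr.symm (infty_mem_rationalPoints K)
    ((coe_mem_rationalPoints_iff K).2 ⟨0, map_zero _⟩) (fun h => hyB r h yr)
    (fun h => hyB r' h yr')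
    (hxo.trans (natCard_stabilizer_ge_orderOf xinf))
    (le_trans (by omega) (natCard_stabilizer_ge_orderOf xzero))
    (hyo.trans (natCard_stabilizer_ge_orderOf yr_H))
    (le_trans (by omega) (natCard_stabilizer_ge_orderOf yr_H'))
    (PSL2.unipSubgroup K H)
    (fun g => by
      rw [PSL2.mem_unipSubgroup_iff]
      obtain ⟨g, hg⟩ := g
      obtain ⟨A, rfl⟩ := QuotientGroup.mk_surjective g
      by_cases h1 : (A : PSL(2, F)) = 1
      · refine iff_of_true ⟨0, ?_⟩ (Or.inl (Subtype.ext h1))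
        rw [SL2.unip_zero]; exact h1
      · have h1' : (⟨(A : PSL(2, F)), hg⟩ : H) ≠ 1 := fun h => h1 (congrArg Subtype.val h)
        have hsm : (⟨(A : PSL(2, F)), hg⟩ : H) • (OnePoint.infty : OnePoint K) = OnePoint.infty ↔
            A 1 0 = 0 := PSL2.smul_infty_eq_iff K A
        have hone : (fixedBy (OnePoint K) (⟨(A : PSL(2, F)), hg⟩ : H)).ncard = 1 ↔
            PSL2.traceSq (A : PSL(2, F)) = 4 := PSL2.ncard_fixedBy_eq_one_iff hK h1
        rw [hsm, hone]
        constructor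
        · rintro ⟨b, hb⟩
          have h10 : A 1 0 = 0 := by
            rw [← PSL2.smul_infty_eq_iff K A]
            have hb' : (A : PSL(2, F)) = (SL2.unip b : SL(2, F)) := hb
            rw [hb']
            exact (PSL2.smul_infty_eq_iff K _).2 rfl
          exact Or.inr ⟨h10, (PSL2.traceSq_eq_four_iff_of_upper h10).2 ⟨b, hb⟩⟩
        · rintro (h | ⟨h10, h4⟩)
          · exact absurd h h1'
          · exact (PSL2.traceSq_eq_four_iff_of_upper h10).1 h4)
    (k := k) (by rw [PSL2.card_unipSubgroup]; exact PSL2.card_stabilizer_infty K H) hk4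
    (by rw [PSL2.card_unipSubgroup]; exact PSL2.card_multiplierHom_range_lt K H)
  rw [PSL2.card_unipSubgroup] at hcard
  replace hcard : (k + 1 = Nat.card Q ∧ Nat.card (stabilizer H r) = Nat.card Q + 1) ∨
      (2 * k + 1 = Nat.card Q ∧ 2 * Nat.card (stabilizer H r) = Nat.card Q + 1) := hcard
  have hQ1 : Nat.card Q ≠ 1 := by omega
  -- the multipliers are nonzero elements of the multiplier subfield of `Q`
  have hkE : k + 1 ≤ Nat.card Q.multiplierSubfield := by
    have hc : (Q.multiplierSubfield : Set F).ncard = Nat.card Q.multiplierSubfield := rfl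
    rw [← hc, ← Set.ncard_sdiff_singleton_add_one (zero_mem Q.multiplierSubfield)
      (Set.toFinite _), add_le_add_iff_right, ← Nat.card_coe_set_eq]
    refine Nat.card_le_card_of_injective (fun m => ⟨(m : Fˣ), ?_, Units.ne_zero _⟩) ?_
    · intro b hb
      exact PSL2.multiplier_mul_mem K H m.2 hb
    · intro m m' h
      exact Subtype.ext (Units.ext (congrArg Subtype.val h))
  have hQE := Q.card_eq_card_multiplierSubfield hQ1 hkE (by omega)
  obtain ⟨j, hj⟩ := Q.multiplierSubfield.exists_card_eq_ringChar_pow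
  refine ⟨j, ?_, ?_, ?_⟩
  · rw [← hj]
    refine Q.multiplierSubfield.card_sq_le_or_eq_top.resolve_right fun h => hH ?_
    have htop : Q = ⊤ := AddSubgroup.eq_top_of_card_eq Q (hQE.trans h)
    refine PSL2.eq_top_of_unip_mem (fun b => ?_) hy fun h10 => hirr (B 0 0) ?_
    · rw [← PSL2.mem_unipGroup]
      change b ∈ Q
      rw [htop]; trivial
    · linear_combination -SL2.det_eq B - B 0 1 * h10
  · rw [← hj, ← hQE]
    refine hχ _ ?_
    have : χ xs ^ k = 1 := by
      have := pow_card_eq_one' (x := (⟨χ xs, ⟨xs, rfl⟩⟩ : χ.range))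
      exact congrArg Subtype.val this
    obtain ⟨c, hc⟩ : k ∣ Nat.card Q - 1 := by
      rcases hcard with h | h
      · exact ⟨1, by omega⟩
      · exact ⟨2, by omega⟩
    rw [hc, pow_mul, this, one_pow]
  · rw [← hj, ← hQE]
    have hyn := congrArg Subtype.val (pow_natCard_stabilizer yr_H)
    have hyn' : (B : PSL(2, F)) ^ Nat.card (stabilizer H r) = 1 := hyn
    obtain ⟨c, hc⟩ : Nat.card (stabilizer H r) ∣ Nat.card Q + 1 := by
      rcases hcard with h | h
      · exact ⟨1, by omega⟩
      · exact ⟨2, by omega⟩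
    rw [hc, pow_mul, hyn', one_pow]

end SubfieldTheorem

/-! ### Conjugacy classes of `PSL(2, F)` -/

section Classes

universe u

variable {F : Type u} [Field F]

/-- The companion matrix of `X ^ 2 - t X + 1`. -/
def SL2.companion (t : F) : SL(2, F) := SL2.of 0 (-1) 1 t (by ring)

theorem isSquare_mul_of_not_isSquare [Finite F] {a b : F} (ha : ¬IsSquare a) (hb : ¬IsSquare b) :
    IsSquare (a * b) := by
  classical
  have := Fintype.ofFinite F
  have h2 : ringChar F ≠ 2 := fun h => ha (FiniteField.isSquare_of_char_two h a)
  have ha0 : a ≠ 0 := by rintro rfl; exact ha (IsSquare.zero)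
  have hb0 : b ≠ 0 := by rintro rfl; exact hb (IsSquare.zero)
  rw [← quadraticChar_neg_one_iff_not_isSquare] at ha hb
  rw [← quadraticChar_one_iff_isSquare (mul_ne_zero ha0 hb0), map_mul, ha, hb]
  norm_num

/-- A nondegenerate binary quadratic form over a finite field represents `1`; here the form
`v ↦ det (v, A v)` attached to a matrix `A`, whose discriminant is `(tr A) ^ 2 - 4`. -/
theorem SL2.exists_cyclic_vector [Finite F] (A : SL(2, F)) (h4 : (A 0 0 + A 1 1) ^ 2 ≠ 4) :
    ∃ x y : F, x * (A 1 0 * x + A 1 1 * y) - y * (A 0 0 * x + A 0 1 * y) = 1 := by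
  have := Fintype.ofFinite F
  have hd := SL2.det_eq A
  set a := A 0 0
  set b := A 0 1
  set c := A 1 0
  set d := A 1 1
  by_cases hc : c = 0
  · have had : d - a ≠ 0 := by
      intro h
      apply h4
      linear_combination 4 * hd + 4 * b * hc + (d - a) * h
    refine ⟨(1 + b) / (d - a), 1, ?_⟩
    rw [hc]
    field_simp
    ring
  by_cases h2 : ringChar F = 2
  · obtain ⟨r, hr⟩ := FiniteField.isSquare_of_char_two h2 c⁻¹
    refine ⟨r, 0, ?_⟩
    have : c * (r * r) = 1 := by rw [← hr, mul_inv_cancel₀ hc]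
    linear_combination this
  · have h2' : (2 : F) ≠ 0 := Ring.two_ne_zero h2
    have hodd : Fintype.card F % 2 = 1 := FiniteField.odd_card_of_char_ne_two h2
    have hD : -((a + d) ^ 2 - 4) ≠ 0 := neg_ne_zero.2 (sub_ne_zero.2 h4)
    obtain ⟨x, y, hxy⟩ := FiniteField.exists_root_sum_quadratic
      (f := Polynomial.C 1 * Polynomial.X ^ 2 + Polynomial.C 0 * Polynomial.X +
        Polynomial.C (-(4 * c)))
      (g := Polynomial.C (-((a + d) ^ 2 - 4)) * Polynomial.X ^ 2 +
        Polynomial.C 0 * Polynomial.X + Polynomial.C 0)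
      (Polynomial.degree_quadratic one_ne_zero) (Polynomial.degree_quadratic hD) hodd
    simp only [Polynomial.eval_add, Polynomial.eval_mul, Polynomial.eval_C, Polynomial.eval_pow,
      Polynomial.eval_X] at hxy
    refine ⟨(x - (d - a) * y) / (2 * c), y, ?_⟩
    field_simp
    linear_combination hxy + 4 * y ^ 2 * hd

theorem SL2.isConj_companion [Finite F] {A : SL(2, F)} (h4 : (A 0 0 + A 1 1) ^ 2 ≠ 4) :
    IsConj (SL2.companion (A 0 0 + A 1 1)) A := by
  obtain ⟨x, y, hxy⟩ := SL2.exists_cyclic_vector A h4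
  have hd := SL2.det_eq A
  rw [isConj_iff]
  refine ⟨SL2.of x (A 0 0 * x + A 0 1 * y) y (A 1 0 * x + A 1 1 * y)
    (by linear_combination hxy), ?_⟩
  rw [mul_inv_eq_iff_eq_mul]
  apply SL2.ext' <;> simp only [SL2.companion, SL2.mul_apply_00, SL2.mul_apply_01,
    SL2.mul_apply_10, SL2.mul_apply_11, SL2.of_00, SL2.of_01, SL2.of_10, SL2.of_11]
  · ring
  · linear_combination x * hd
  · ring
  · linear_combination y * hd

theorem PSL2.coe_neg (A : SL(2, F)) : ((-A : SL(2, F)) : PSL(2, F)) = A :=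
  PSL2.coe_eq_coe.2 (Or.inr rfl)

/-- Elements of `PSL(2, F)` with the same square trace, different from `4`, are conjugate. -/
theorem PSL2.isConj_of_traceSq_eq [Finite F] {g h : PSL(2, F)} (h4 : PSL2.traceSq g ≠ 4)
    (hgh : PSL2.traceSq g = PSL2.traceSq h) : IsConj g h := by
  obtain ⟨A, rfl⟩ := QuotientGroup.mk_surjective g
  obtain ⟨B, rfl⟩ := QuotientGroup.mk_surjective h
  have key : ∀ B : SL(2, F), A 0 0 + A 1 1 = B 0 0 + B 1 1 →
      IsConj (A : PSL(2, F)) (B : PSL(2, F)) := by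
    intro B hAB
    have h1 := SL2.isConj_companion (A := A) h4
    have h2 := SL2.isConj_companion (A := B) (by rw [← hAB]; exact h4)
    rw [hAB] at h1
    exact (QuotientGroup.mk' (Subgroup.center SL(2, F))).map_isConj (h1.symm.trans h2)
  rw [PSL2.traceSq_coe, PSL2.traceSq_coe, sq_eq_sq_iff_eq_or_eq_neg] at hgh
  rcases hgh with h | h
  · exact key B h
  · have := key (-B) (by simp only [SL2.neg_apply]; rw [h]; ring)
    rwa [PSL2.coe_neg] at this

theorem PSL2.traceSq_eq_of_isConj {g h : PSL(2, F)} (hgh : IsConj g h) :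
    PSL2.traceSq g = PSL2.traceSq h := by
  obtain ⟨c, rfl⟩ := isConj_iff.1 hgh
  obtain ⟨A, rfl⟩ := QuotientGroup.mk_surjective g
  obtain ⟨P, rfl⟩ := QuotientGroup.mk_surjective c
  have hd := SL2.det_eq P
  rw [← QuotientGroup.mk_inv, ← QuotientGroup.mk_mul, ← QuotientGroup.mk_mul, PSL2.traceSq_coe,
    PSL2.traceSq_coe]
  congr 1
  rw [SL2.inv_eq_of]
  simp only [SL2.mul_apply_00, SL2.mul_apply_01,
    SL2.mul_apply_10, SL2.mul_apply_11, SL2.of_00, SL2.of_01, SL2.of_10, SL2.of_11]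
  linear_combination -(A 0 0 + A 1 1) * hd

/-- The square trace of a conjugacy class. -/
def PSL2.classTraceSq : ConjClasses PSL(2, F) → F :=
  Quotient.lift PSL2.traceSq (fun _ _ h => PSL2.traceSq_eq_of_isConj h)

theorem PSL2.classTraceSq_mk (g : PSL(2, F)) :
    PSL2.classTraceSq (ConjClasses.mk g) = PSL2.traceSq g := rfl

theorem PSL2.classTraceSq_injOn [Finite F] :
    Set.InjOn (PSL2.classTraceSq (F := F)) {C | PSL2.classTraceSq C ≠ 4} := by
  intro C hC D _ h
  obtain ⟨g, rfl⟩ := ConjClasses.mk_surjective C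
  obtain ⟨k, rfl⟩ := ConjClasses.mk_surjective D
  exact ConjClasses.mk_eq_mk_iff_isConj.2 (PSL2.isConj_of_traceSq_eq hC h)

/-- An element of square trace `4` is conjugate to a unitriangular one. -/
theorem PSL2.exists_isConj_unip {g : PSL(2, F)} (h4 : PSL2.traceSq g = 4) :
    ∃ b : F, IsConj (SL2.unip b : PSL(2, F)) g := by
  have key : ∀ A : SL(2, F), A 0 0 + A 1 1 = 2 →
      ∃ b : F, IsConj (SL2.unip b : PSL(2, F)) (A : PSL(2, F)) := by
    intro A hA
    have hd := SL2.det_eq A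
    by_cases hc : A 1 0 = 0
    · obtain ⟨b, hb⟩ := (PSL2.traceSq_eq_four_iff_of_upper hc).1
        (by rw [PSL2.traceSq_coe, hA]; norm_num)
      exact ⟨b, hb ▸ IsConj.refl _⟩
    · refine ⟨-(A 1 0)⁻¹, (QuotientGroup.mk' (Subgroup.center SL(2, F))).map_isConj
        (isConj_iff.2 ⟨SL2.of (A 0 0 - 1) (-(A 1 0)⁻¹) (A 1 0) 0 (by field_simp; ring), ?_⟩)⟩
      rw [mul_inv_eq_iff_eq_mul]
      apply SL2.ext' <;> simp only [SL2.unip, SL2.mul_apply_00, SL2.mul_apply_01,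
        SL2.mul_apply_10, SL2.mul_apply_11, SL2.of_00, SL2.of_01, SL2.of_10, SL2.of_11]
      · linear_combination hd - A 0 0 * hA
      · field_simp
        ring
      · linear_combination -A 1 0 * hA
      · field_simp
        ring
  obtain ⟨A, rfl⟩ := QuotientGroup.mk_surjective g
  rw [PSL2.traceSq_coe, show (4 : F) = 2 ^ 2 by norm_num, sq_eq_sq_iff_eq_or_eq_neg] at h4
  rcases h4 with h | h
  · exact key A h
  · obtain ⟨b, hb⟩ := key (-A) (by simp only [SL2.neg_apply]; linear_combination -h)
    exact ⟨b, by rwa [PSL2.coe_neg] at hb⟩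

theorem PSL2.isConj_unip_mul_sq (b : F) {l : F} (hl : l ≠ 0) :
    IsConj (SL2.unip b : PSL(2, F)) (SL2.unip (l ^ 2 * b) : SL(2, F)) := by
  refine (QuotientGroup.mk' (Subgroup.center SL(2, F))).map_isConj
    (isConj_iff.2 ⟨SL2.diag l hl, ?_⟩)
  exact SL2.conj_unip (A := SL2.diag l hl) rfl b

/-- There are at most three classes of square trace `4`. -/
theorem PSL2.ncard_unipotent_classes_le [Finite F] :
    {C : ConjClasses PSL(2, F) | PSL2.classTraceSq C = 4}.ncard ≤ 3 := by
  classical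
  obtain ⟨v, hv⟩ : ∃ v : F, ∀ b : F, ¬IsSquare b → ¬IsSquare v := by
    by_cases h : ∃ v : F, ¬IsSquare v
    · obtain ⟨v, hv⟩ := h
      exact ⟨v, fun _ _ => hv⟩
    · push Not at h
      exact ⟨0, fun b hb => absurd (h b) hb⟩
  let u : F → ConjClasses PSL(2, F) := fun b => ConjClasses.mk (SL2.unip b : SL(2, F))
  have hsub : {C : ConjClasses PSL(2, F) | PSL2.classTraceSq C = 4} ⊆ {u 0, u 1, u v} := by
    intro C hC
    obtain ⟨g, rfl⟩ := ConjClasses.mk_surjective C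
    obtain ⟨b, hb⟩ := PSL2.exists_isConj_unip hC
    have hgb : ConjClasses.mk g = u b := (ConjClasses.mk_eq_mk_iff_isConj.2 hb).symm
    rw [hgb]
    have hu : ∀ {b c l : F}, l ≠ 0 → c = l ^ 2 * b → u c = u b := by
      rintro b c l hl rfl
      exact (ConjClasses.mk_eq_mk_iff_isConj.2 (PSL2.isConj_unip_mul_sq b hl)).symm
    by_cases hb0 : b = 0
    · left; rw [hb0]
    by_cases hbs : IsSquare b
    · right; left
      obtain ⟨l, hl⟩ := hbs
      exact hu (l := l) (by rintro rfl; simp at hl; exact hb0 hl) (by rw [hl]; ring)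
    · right; right
      have hv' := hv b hbs
      have hv0 : v ≠ 0 := by rintro rfl; exact hv' IsSquare.zero
      obtain ⟨l, hl⟩ := isSquare_mul_of_not_isSquare hbs hv'
      have hl0 : l ≠ 0 := by
        rintro rfl
        exact mul_ne_zero hb0 hv0 (by simpa using hl)
      refine hu (l := l / v) (div_ne_zero hl0 hv0) ?_
      field_simp
      linear_combination hl
  refine (Set.ncard_le_ncard hsub (Set.toFinite _)).trans ?_
  refine (Set.ncard_insert_le _ _).trans ?_
  have := Set.ncard_insert_le (u 1) {u v}
  rw [Set.ncard_singleton] at this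
  omega

end Classes

/-! ### Invariable generation by two classes -/

section InvariableGeneration

theorem not_invariablyGenerates_of_subgroup {G : Type*} [Group G] {D : Subgroup G} (hD : D ≠ ⊤)
    {C₁ C₂ : ConjClasses G} (h₁ : ∃ g ∈ D, ConjClasses.mk g = C₁)
    (h₂ : ∃ g ∈ D, ConjClasses.mk g = C₂) : ¬InvariablyGenerates {C₁, C₂} := by
  classical
  intro h
  let x : ConjClasses G → G := fun C =>
    if hC : ∃ g ∈ D, ConjClasses.mk g = C then hC.choose else (ConjClasses.mk_surjective C).choose
  have hx : ∀ C, (∃ g ∈ D, ConjClasses.mk g = C) → x C ∈ D ∧ ConjClasses.mk (x C) = C := by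
    intro C hC
    have : x C = hC.choose := dif_pos hC
    rw [this]
    exact hC.choose_spec
  have hall : ∀ C ∈ ({C₁, C₂} : Set (ConjClasses G)), x C ∈ D ∧ ConjClasses.mk (x C) = C := by
    rintro C (rfl | rfl)
    · exact hx _ h₁
    · exact hx _ h₂
  refine hD (top_le_iff.1 ?_)
  rw [← h x fun C hC => ConjClasses.mem_carrier_iff_mk_eq.2 (hall C hC).2, Subgroup.closure_le]
  rintro _ ⟨C, hC, rfl⟩
  exact (hall C hC).1

/-- If two classes do not invariably generate, then some element of the second class and any
prescribed element of the first one lie in a common proper subgroup. -/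
theorem exists_proper_subgroup_of_not_invariablyGenerates {G : Type*} [Group G]
    {C₁ C₂ : ConjClasses G} (h : ¬InvariablyGenerates {C₁, C₂}) {a : G}
    (ha : ConjClasses.mk a = C₁) :
    ∃ (D : Subgroup G) (b : G), D ≠ ⊤ ∧ ConjClasses.mk b = C₂ ∧ a ∈ D ∧ b ∈ D := by
  unfold InvariablyGenerates at h
  push Not at h
  obtain ⟨x, hx, hne⟩ := h
  have h₁ := ConjClasses.mem_carrier_iff_mk_eq.1 (hx C₁ (by simp))
  have h₂ := ConjClasses.mem_carrier_iff_mk_eq.1 (hx C₂ (by simp))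
  obtain ⟨c, hc⟩ := isConj_iff.1 (ConjClasses.mk_eq_mk_iff_isConj.1 (h₁.trans ha.symm))
  refine ⟨(Subgroup.closure (x '' {C₁, C₂})).map (MulAut.conj c).toMonoidHom, c * x C₂ * c⁻¹,
    fun htop => hne ?_, ?_, ?_, ?_⟩
  · rw [← Subgroup.map_top_of_surjective (MulAut.conj c).toMonoidHom
      (MulAut.conj c).surjective] at htop
    exact Subgroup.map_injective (MulAut.conj c).injective htop
  · exact (ConjClasses.mk_eq_mk_iff_isConj.2 (isConj_iff.2 ⟨c⁻¹, by group⟩)).trans h₂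
  · exact ⟨x C₁, Subgroup.subset_closure ⟨C₁, by simp, rfl⟩, hc⟩
  · exact ⟨x C₂, Subgroup.subset_closure ⟨C₂, by simp, rfl⟩, rfl⟩

end InvariableGeneration

/-- The elements of the class `C` satisfy `g ^ n = 1`. -/
def ConjClasses.PowEqOne {G : Type*} [Group G] (C : ConjClasses G) (n : ℕ) : Prop :=
  ∃ g : G, ConjClasses.mk g = C ∧ g ^ n = 1

section SplitNonsplit

universe u

variable {F : Type u} [Field F]

/-- The conjugacy classes of nontrivial split semisimple elements of `PSL(2, F)`: those of square
trace `(l + l⁻¹) ^ 2 ≠ 4`. -/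
def PSL2.splitClasses (F : Type u) [Field F] : Set (ConjClasses PSL(2, F)) :=
  {C | PSL2.classTraceSq C ≠ 4 ∧ ∃ l : F, l ≠ 0 ∧ PSL2.classTraceSq C = (l + l⁻¹) ^ 2}

/-- The conjugacy classes of elements of `PSL(2, F)` without eigenvalues in `F`. -/
def PSL2.nonsplitClasses (F : Type u) [Field F] : Set (ConjClasses PSL(2, F)) :=
  {C | PSL2.classTraceSq C ≠ 4 ∧ ¬∃ l : F, l ≠ 0 ∧ PSL2.classTraceSq C = (l + l⁻¹) ^ 2}

theorem PSL2.exists_diag_of_mem_splitClasses [Finite F] {C : ConjClasses PSL(2, F)}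
    (hC : C ∈ PSL2.splitClasses F) :
    ∃ (l : F) (hl : l ≠ 0), ConjClasses.mk (SL2.diag l hl : PSL(2, F)) = C := by
  obtain ⟨h4, l, hl, h⟩ := hC
  obtain ⟨g, rfl⟩ := ConjClasses.mk_surjective C
  have h' : PSL2.traceSq g = PSL2.traceSq (SL2.diag l hl : PSL(2, F)) := h
  exact ⟨l, hl, ConjClasses.mk_eq_mk_iff_isConj.2 (PSL2.isConj_of_traceSq_eq h4 h').symm⟩

theorem PSL2.no_eigenvalue_of_mem_nonsplitClasses {B : SL(2, F)}
    (hB : ConjClasses.mk (B : PSL(2, F)) ∈ PSL2.nonsplitClasses F) (μ : F) :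
    μ ^ 2 - (B 0 0 + B 1 1) * μ + 1 ≠ 0 := by
  intro h
  have h0 : μ ≠ 0 := by rintro rfl; simp at h
  refine hB.2 ⟨μ, h0, ?_⟩
  rw [PSL2.classTraceSq_mk, PSL2.traceSq_coe]
  congr 1
  field_simp
  linear_combination -h

theorem PSL2.not_invariablyGenerates_of_split [Finite F] {C₁ C₂ : ConjClasses PSL(2, F)}
    (h₁ : C₁ ∈ PSL2.splitClasses F) (h₂ : C₂ ∈ PSL2.splitClasses F) :
    ¬InvariablyGenerates {C₁, C₂} := by
  have hD : stabilizer PSL(2, F) (OnePoint.infty : OnePoint F) ≠ ⊤ := by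
    intro h
    have hm : (SL2.companion (0 : F) : PSL(2, F)) ∈
        stabilizer PSL(2, F) (OnePoint.infty : OnePoint F) := by rw [h]; trivial
    exact one_ne_zero ((PSL2.smul_infty_eq_iff F _).1 hm)
  obtain ⟨l, hl, rfl⟩ := PSL2.exists_diag_of_mem_splitClasses h₁
  obtain ⟨m, hm, rfl⟩ := PSL2.exists_diag_of_mem_splitClasses h₂
  exact not_invariablyGenerates_of_subgroup hD
    ⟨_, (PSL2.smul_infty_eq_iff F _).2 rfl, rfl⟩ ⟨_, (PSL2.smul_infty_eq_iff F _).2 rfl, rfl⟩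

/-- In characteristic two the elements `s ^ 2 + s` form a subgroup of index two. -/
theorem exists_sq_add_self_eq_add [Finite F] (h2 : (2 : F) = 0) {a b : F}
    (ha : ∀ s : F, s ^ 2 + s ≠ a) (hb : ∀ s : F, s ^ 2 + s ≠ b) : ∃ s : F, s ^ 2 + s = a + b := by
  let f : F →+ F :=
    { toFun := fun s => s ^ 2 + s
      map_zero' := by simp
      map_add' := by intro x y; linear_combination x * y * h2 }
  have hker : (f.ker : Set F) = {0, 1} := by
    ext s
    have : s ∈ f.ker ↔ s ^ 2 + s = 0 := Iff.rfl
    rw [SetLike.mem_coe, this, Set.mem_insert_iff, Set.mem_singleton_iff]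
    constructor
    · intro h
      have : s * (s - 1) = 0 := by linear_combination h - s * h2
      rcases mul_eq_zero.1 this with h | h
      · exact Or.inl h
      · exact Or.inr (sub_eq_zero.1 h)
    · rintro (rfl | rfl)
      · simp
      · linear_combination h2
  have hk2 : Nat.card f.ker = 2 := by
    have : Nat.card f.ker = (f.ker : Set F).ncard := rfl
    rw [this, hker, Set.ncard_pair zero_ne_one]
  have hindex : f.range.index = 2 := by
    have h1 := AddSubgroup.card_mul_index f.range
    have h3 := AddSubgroup.card_mul_index f.ker
    rw [AddSubgroup.index_ker, hk2] at h3
    have hpos : 0 < Nat.card f.range := Nat.card_pos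
    rw [← h3, mul_comm 2] at h1
    exact Nat.eq_of_mul_eq_mul_left hpos h1
  have hmem := AddSubgroup.add_mem_iff_of_index_two hindex (a := a) (b := b)
  have ha' : a ∉ f.range := by rintro ⟨s, hs⟩; exact ha s hs
  have hb' : b ∉ f.range := by rintro ⟨s, hs⟩; exact hb s hs
  obtain ⟨s, hs⟩ := hmem.2 (iff_of_false ha' hb')
  exact ⟨s, hs⟩

/-- If `X ^ 2 - t X + 1` and `X ^ 2 - u X + 1` are irreducible over a finite field, then the
quadratic extension generated by a root of the first one contains an element `α + β θ` of
trace `u` and norm `1`. -/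
theorem exists_trace_norm_one [Finite F] {t u : F} (ht : ∀ μ : F, μ ^ 2 - t * μ + 1 ≠ 0)
    (hu : ∀ μ : F, μ ^ 2 - u * μ + 1 ≠ 0) :
    ∃ α β : F, 2 * α + β * t = u ∧ α ^ 2 + α * β * t + β ^ 2 = 1 := by
  by_cases h2 : (2 : F) = 0
  · have key : ∀ {t : F}, (∀ μ : F, μ ^ 2 - t * μ + 1 ≠ 0) →
        t ≠ 0 ∧ ∀ s : F, s ^ 2 + s ≠ (t ^ 2)⁻¹ := by
      intro t ht
      have h0 : t ≠ 0 := by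
        rintro rfl
        exact ht 1 (by linear_combination h2)
      refine ⟨h0, fun s hs => ht (t * s) ?_⟩
      have : t ^ 2 * (s ^ 2 + s) = 1 := by rw [hs, mul_inv_cancel₀ (pow_ne_zero 2 h0)]
      linear_combination this + (1 - t ^ 2 * s) * h2
    obtain ⟨ht0, ht'⟩ := key ht
    obtain ⟨hu0, hu'⟩ := key hu
    obtain ⟨s, hs⟩ := exists_sq_add_self_eq_add h2 ht' hu'
    refine ⟨u * s, u / t, ?_, ?_⟩
    · field_simp
      linear_combination s * h2
    · field_simp at hs ⊢
      linear_combination hs + u ^ 2 * h2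
  · have key : ∀ {t : F}, (∀ μ : F, μ ^ 2 - t * μ + 1 ≠ 0) → ¬IsSquare (t ^ 2 - 4) := by
      rintro t ht ⟨r, hr⟩
      refine ht ((t + r) / 2) ?_
      field_simp
      linear_combination -hr
    have ht' := key ht
    obtain ⟨r, hr⟩ := isSquare_mul_of_not_isSquare ht' (key hu)
    have hD : t ^ 2 - 4 ≠ 0 := fun h => ht' (h ▸ IsSquare.zero)
    have hβ : (r / (t ^ 2 - 4)) ^ 2 * (t ^ 2 - 4) = u ^ 2 - 4 := by
      field_simp
      linear_combination -hr
    refine ⟨(u - r / (t ^ 2 - 4) * t) / 2, r / (t ^ 2 - 4), ?_, ?_⟩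
    · field_simp
      ring
    · generalize r / (t ^ 2 - 4) = β at hβ ⊢
      field_simp
      linear_combination -hβ

theorem PSL2.not_invariablyGenerates_of_nonsplit [Finite F] {C₁ C₂ : ConjClasses PSL(2, F)}
    (h₁ : C₁ ∈ PSL2.nonsplitClasses F) (h₂ : C₂ ∈ PSL2.nonsplitClasses F) :
    ¬InvariablyGenerates {C₁, C₂} := by
  obtain ⟨g, rfl⟩ := ConjClasses.mk_surjective C₁
  obtain ⟨k, rfl⟩ := ConjClasses.mk_surjective C₂
  obtain ⟨A, rfl⟩ := QuotientGroup.mk_surjective g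
  obtain ⟨B, rfl⟩ := QuotientGroup.mk_surjective k
  have hA := PSL2.no_eigenvalue_of_mem_nonsplitClasses h₁
  obtain ⟨α, β, htr, hnorm⟩ := exists_trace_norm_one hA
    (PSL2.no_eigenvalue_of_mem_nonsplitClasses h₂)
  have hd := SL2.det_eq A
  have hc : A 1 0 ≠ 0 := by
    intro h10
    exact hA (A 0 0) (by linear_combination -hd - A 0 1 * h10)
  -- the element `α + β A` of the torus containing `A` represents the second class
  let A' : SL(2, F) := SL2.of (α + β * A 0 0) (β * A 0 1) (β * A 1 0) (α + β * A 1 1)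
    (by linear_combination hnorm + β ^ 2 * hd)
  have hcomm : A' * A = A * A' := by
    apply SL2.ext' <;> simp only [A', SL2.mul_apply_00, SL2.mul_apply_01,
      SL2.mul_apply_10, SL2.mul_apply_11, SL2.of_00, SL2.of_01, SL2.of_10, SL2.of_11] <;> ring
  have hD : Subgroup.centralizer {(A : PSL(2, F))} ≠ ⊤ := by
    intro h
    have hm : (SL2.unip (1 : F) : PSL(2, F)) ∈ Subgroup.centralizer {(A : PSL(2, F))} := by
      rw [h]; trivial
    rw [Subgroup.mem_centralizer_singleton_iff, ← QuotientGroup.mk_mul,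
      ← QuotientGroup.mk_mul, PSL2.coe_eq_coe] at hm
    have e10 : (SL2.unip 1 * A : SL(2, F)) 1 0 = A 1 0 := by
      simp [SL2.unip, SL2.mul_apply_10]
    have e10' : (A * SL2.unip 1 : SL(2, F)) 1 0 = A 1 0 := by
      simp [SL2.unip, SL2.mul_apply_10]
    have e11 : (SL2.unip 1 * A : SL(2, F)) 1 1 = A 1 1 := by
      simp [SL2.unip, SL2.mul_apply_11]
    have e11' : (A * SL2.unip 1 : SL(2, F)) 1 1 = A 1 0 + A 1 1 := by
      simp [SL2.unip, SL2.mul_apply_11]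
    have e00 : (SL2.unip 1 * A : SL(2, F)) 0 0 = A 0 0 + A 1 0 := by
      simp [SL2.unip, SL2.mul_apply_00]
    have e00' : (A * SL2.unip 1 : SL(2, F)) 0 0 = A 0 0 := by
      simp [SL2.unip, SL2.mul_apply_00]
    rcases hm with hm | hm
    · rw [hm] at e11
      exact hc (by linear_combination e11 - e11')
    · rw [hm, SL2.neg_apply] at e10 e00
      have h2 : 2 * A 1 0 = 0 := by linear_combination -e10 - e10'
      rcases mul_eq_zero.1 h2 with h2 | h2
      · exact hc (by linear_combination -e00 - e00' - A 0 0 * h2)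
      · exact hc h2
  refine not_invariablyGenerates_of_subgroup hD
    ⟨_, Subgroup.mem_centralizer_singleton_iff.2 rfl, rfl⟩ ⟨(A' : PSL(2, F)), ?_, ?_⟩
  · rw [Subgroup.mem_centralizer_singleton_iff, ← QuotientGroup.mk_mul, ← QuotientGroup.mk_mul,
      hcomm]
  · refine ConjClasses.mk_eq_mk_iff_isConj.2 (PSL2.isConj_of_traceSq_eq
      (g := (B : PSL(2, F))) h₂.1 ?_).symm
    rw [PSL2.traceSq_coe, PSL2.traceSq_coe, ← htr]
    simp only [A', SL2.of_00, SL2.of_11]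
    ring

/-- If a split and a nonsplit class do not invariably generate, then one of them consists of
elements of order less than `4`, or the orders of the elements of the two classes divide `m - 1` and
`m + 1`, where `m` is a power of the characteristic with `m ^ 2 ≤ q`. -/
theorem PSL2.cases_of_not_invariablyGenerates [Finite F] {C₁ C₂ : ConjClasses PSL(2, F)}
    (h₁ : C₁ ∈ PSL2.splitClasses F) (h₂ : C₂ ∈ PSL2.nonsplitClasses F)
    (h : ¬InvariablyGenerates {C₁, C₂}) :
    (∃ i ∈ Finset.Icc 1 3, C₁.PowEqOne i ∨ C₂.PowEqOne i) ∨
    ∃ j, j ≠ 0 ∧ (ringChar F ^ j) ^ 2 ≤ Nat.card F ∧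
      C₁.PowEqOne (ringChar F ^ j - 1) ∧ C₂.PowEqOne (ringChar F ^ j + 1) := by
  obtain ⟨l, hl, hlC⟩ := PSL2.exists_diag_of_mem_splitClasses h₁
  obtain ⟨D, b, hD, rfl, hx, hy⟩ := exists_proper_subgroup_of_not_invariablyGenerates h hlC
  obtain ⟨B, rfl⟩ := QuotientGroup.mk_surjective b
  have hsmall : ∀ g : PSL(2, F), orderOf g < 4 → orderOf g ∈ Finset.Icc 1 3 := fun g hg =>
    Finset.mem_Icc.2 ⟨orderOf_pos g, by omega⟩
  by_cases hx4 : orderOf (SL2.diag l hl : PSL(2, F)) < 4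
  · exact Or.inl ⟨_, hsmall _ hx4, Or.inl ⟨_, hlC, pow_orderOf_eq_one _⟩⟩
  by_cases hy4 : orderOf (B : PSL(2, F)) < 4
  · exact Or.inl ⟨_, hsmall _ hy4, Or.inr ⟨_, rfl, pow_orderOf_eq_one _⟩⟩
  right
  obtain ⟨j, hj, hxj, hyj⟩ := PSL2.exists_subfield_card_of_ne_top hl hx (not_lt.1 hx4) hy
    (PSL2.no_eigenvalue_of_mem_nonsplitClasses h₂) (not_lt.1 hy4) hD
  refine ⟨j, ?_, hj, ⟨_, hlC, hxj⟩, ⟨_, rfl, hyj⟩⟩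
  rintro rfl
  have := orderOf_le_of_pow_eq_one (by omega) hyj
  rw [pow_zero] at this
  omega

end SplitNonsplit

/-! ### Counting conjugacy classes -/

section ClassCounts

universe u

variable {F : Type u} [Field F]

theorem SL2.eigenvalue_pow_eq_one {K : Type*} [Field K] [Algebra F K] {A : SL(2, F)} {n : ℕ}
    (hA : A ^ n = 1) {μ : K} (hμ : μ ^ 2 - algebraMap F K (A 0 0 + A 1 1) * μ + 1 = 0) :
    μ ^ n = 1 := by
  set M : Matrix (Fin 2) (Fin 2) K := (algebraMap F K).mapMatrix (A : Matrix (Fin 2) (Fin 2) F)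
  have hM : M ^ n = 1 := by
    have h : (A : Matrix (Fin 2) (Fin 2) F) ^ n = 1 := by
      rw [← Matrix.SpecialLinearGroup.coe_pow, hA, Matrix.SpecialLinearGroup.coe_one]
    rw [← map_pow, h, map_one]
  have hd := congrArg (algebraMap F K) (SL2.det_eq A)
  have hs : μ ∈ spectrum K M := by
    rw [spectrum.mem_iff, Matrix.isUnit_iff_isUnit_det, isUnit_iff_ne_zero, not_not,
      Matrix.det_fin_two]
    simp [M, Matrix.algebraMap_matrix_apply] at hd hμ ⊢
    linear_combination hμ + hd
  have := spectrum.pow_mem_pow M n hs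
  rw [hM, spectrum.one_eq] at this
  exact this

theorem ncard_pow_eq_one_le (K : Type*) [Field K] {n : ℕ} (hn : 0 < n) :
    {μ : K | μ ^ n = 1}.ncard ≤ n := by
  classical
  have : {μ : K | μ ^ n = 1} = (Polynomial.nthRoots n (1 : K)).toFinset := by
    ext μ
    simp [Polynomial.mem_nthRoots hn]
  rw [this, Set.ncard_coe_finset]
  exact (Multiset.toFinset_card_le _).trans (Polynomial.card_nthRoots n 1)

/-- At most `2 n` semisimple classes consist of elements with `g ^ n = 1`: such a class is
determined by an eigenvalue, which is a root of unity of order dividing `2 n`. -/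
theorem PSL2.ncard_powEqOne_le [Finite F] {n : ℕ} (hn : 0 < n) :
    {C : ConjClasses PSL(2, F) | PSL2.classTraceSq C ≠ 4 ∧ C.PowEqOne n}.ncard ≤ 2 * n := by
  obtain ⟨K, _, _, _, hK⟩ := exists_finite_extension_splitting F
  have hinj : Set.InjOn (fun C : ConjClasses PSL(2, F) => algebraMap F K (PSL2.classTraceSq C))
      {C : ConjClasses PSL(2, F) | PSL2.classTraceSq C ≠ 4 ∧ C.PowEqOne n} := by
    intro C hC D hD h
    exact PSL2.classTraceSq_injOn hC.1 hD.1 ((algebraMap F K).injective h)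
  rw [← Set.InjOn.ncard_image hinj]
  refine le_trans (Set.ncard_le_ncard (t := (fun μ : K => (μ + μ⁻¹) ^ 2) ''
    {μ : K | μ ^ (2 * n) = 1}) ?_ (Set.toFinite _)) ((Set.ncard_image_le (Set.toFinite _)).trans
      (ncard_pow_eq_one_le K (by omega)))
  rintro _ ⟨C, ⟨-, g, rfl, hg⟩, rfl⟩
  obtain ⟨A, rfl⟩ := QuotientGroup.mk_surjective g
  obtain ⟨μ, hμ⟩ := hK (A 0 0 + A 1 1)
  refine ⟨μ, SL2.eigenvalue_pow_eq_one (A := A) ?_ hμ, ?_⟩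
  · rw [← QuotientGroup.mk_pow] at hg
    rw [mul_comm, pow_mul]
    rcases PSL2.coe_eq_one.1 hg with h | h <;> rw [h] <;> simp
  · have h0 : μ ≠ 0 := by rintro rfl; simp at hμ
    simp only [PSL2.classTraceSq_mk, PSL2.traceSq_coe]
    rw [map_pow]
    congr 1
    field_simp
    linear_combination hμ

/-- Squaring is `e`-to-one on a symmetric set not containing `0`, where `e` is the number of
square roots of unity. -/
theorem card_image_sq [DecidableEq F] {X : Finset F} (hX : ∀ t ∈ X, -t ∈ X) (h0 : (0 : F) ∉ X) :
    X.card = (X.image fun t => t ^ 2).card * ({1, -1} : Finset F).card := by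
  rw [Finset.card_eq_sum_card_image (fun t : F => t ^ 2) X, ← smul_eq_mul, ← Finset.sum_const]
  refine Finset.sum_congr rfl fun b hb => ?_
  obtain ⟨t, ht, rfl⟩ := Finset.mem_image.1 hb
  have ht0 : t ≠ 0 := fun h => h0 (h ▸ ht)
  have : X.filter (fun a => a ^ 2 = t ^ 2) = ({1, -1} : Finset F).image (fun a => a * t) := by
    ext a
    simp only [Finset.mem_filter, sq_eq_sq_iff_eq_or_eq_neg, Finset.image_insert,
      Finset.image_singleton, one_mul, neg_mul, Finset.mem_insert, Finset.mem_singleton,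
      and_iff_right_iff_imp]
    rintro (rfl | rfl)
    · exact ht
    · exact hX t ht
  rw [this, Finset.card_image_of_injective _ (mul_left_injective₀ ht0)]

/-- `l ↦ l + l⁻¹` is two-to-one where `l ^ 2 ≠ 1`. -/
theorem card_image_add_inv [DecidableEq F] {X : Finset F} (hX : ∀ l ∈ X, l⁻¹ ∈ X)
    (h0 : ∀ l ∈ X, l ≠ 0 ∧ l ^ 2 ≠ 1) :
    X.card = (X.image fun l => l + l⁻¹).card * 2 := by
  rw [Finset.card_eq_sum_card_image (fun l : F => l + l⁻¹) X, ← smul_eq_mul, ← Finset.sum_const]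
  refine Finset.sum_congr rfl fun b hb => ?_
  obtain ⟨l, hl, rfl⟩ := Finset.mem_image.1 hb
  obtain ⟨hl0, hl1⟩ := h0 l hl
  have : X.filter (fun a => a + a⁻¹ = l + l⁻¹) = {l, l⁻¹} := by
    ext a
    simp only [Finset.mem_filter, Finset.mem_insert, Finset.mem_singleton]
    constructor
    · rintro ⟨ha, h⟩
      have ha0 := (h0 a ha).1
      have : (a - l) * (a - l⁻¹) = 0 := by
        field_simp at h ⊢
        linear_combination h
      exact (mul_eq_zero.1 this).imp sub_eq_zero.1 sub_eq_zero.1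
    · rintro (rfl | rfl)
      · exact ⟨hl, rfl⟩
      · exact ⟨hX l hl, by rw [inv_inv, add_comm]⟩
  rw [this, Finset.card_pair]
  intro h
  apply hl1
  rw [pow_two]
  nth_rewrite 2 [h]
  exact mul_inv_cancel₀ hl0

/-- About half of the nonzero squares are of the form `(l + l⁻¹) ^ 2`. -/
theorem exists_card_squares (F : Type u) [Field F] [Finite F] :
    ∃ A B : Finset F, (∀ v, v ∈ A ↔ v ≠ 0 ∧ ∃ l : F, l ≠ 0 ∧ v = (l + l⁻¹) ^ 2) ∧
      (∀ v, v ∈ B ↔ v ≠ 0 ∧ ∃ t : F, v = t ^ 2) ∧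
      2 * A.card ≤ B.card + 4 ∧ B.card ≤ 2 * A.card + 4 ∧ Nat.card F ≤ 2 * B.card + 1 := by
  classical
  have := Fintype.ofFinite F
  let X : Finset F := Finset.univ.filter fun l => l ≠ 0 ∧ l ^ 2 ≠ 1
  let V : Finset F := (Finset.univ.erase 0).image fun l => l + l⁻¹
  have hq : (Finset.univ.erase (0 : F)).card + 1 = Nat.card F := by
    rw [Finset.card_erase_add_one (Finset.mem_univ _), Finset.card_univ, Nat.card_eq_fintype_card]
  have hXm : ∀ l, l ∈ X ↔ l ≠ 0 ∧ l ^ 2 ≠ 1 := fun l => by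
    simp only [X, Finset.mem_filter, Finset.mem_univ, true_and]
  have hX1 : X.card ≤ (Finset.univ.erase (0 : F)).card :=
    Finset.card_le_card fun l hl => by simpa using ((hXm l).1 hl).1
  have hX2 : (Finset.univ.erase (0 : F)).card ≤ X.card + 2 := by
    have hsub : Finset.univ.erase (0 : F) ⊆ X ∪ {1, -1} := by
      intro l hl
      have hl0 : l ≠ 0 := by simpa using hl
      by_cases h : l ^ 2 = 1
      · rcases sq_eq_one_iff.1 h with rfl | rfl <;> simp
      · exact Finset.mem_union_left _ ((hXm l).2 ⟨hl0, h⟩)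
    exact (Finset.card_le_card hsub).trans ((Finset.card_union_le _ _).trans
      (Nat.add_le_add_left Finset.card_le_two _))
  have hX : X.card = (X.image fun l => l + l⁻¹).card * 2 :=
    card_image_add_inv (fun l hl => (hXm _).2 ⟨inv_ne_zero ((hXm l).1 hl).1, by
      rw [inv_pow, ne_eq, inv_eq_one]; exact ((hXm l).1 hl).2⟩) (fun l hl => (hXm l).1 hl)
  have hV1 : (X.image fun l => l + l⁻¹).card ≤ V.card :=
    Finset.card_le_card (Finset.image_subset_image fun l hl => by simpa using ((hXm l).1 hl).1)
  have hV2 : V.card ≤ (X.image fun l => l + l⁻¹).card + 2 := by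
    have hsub : V ⊆ (X.image fun l => l + l⁻¹) ∪ {1 + 1⁻¹, -1 + (-1)⁻¹} := by
      intro v hv
      obtain ⟨l, hl, rfl⟩ := Finset.mem_image.1 hv
      have hl0 : l ≠ 0 := by simpa using hl
      by_cases h : l ^ 2 = 1
      · rcases sq_eq_one_iff.1 h with rfl | rfl <;> simp
      · exact Finset.mem_union_left _ (Finset.mem_image_of_mem _ ((hXm l).2 ⟨hl0, h⟩))
    exact (Finset.card_le_card hsub).trans ((Finset.card_union_le _ _).trans
      (Nat.add_le_add_left Finset.card_le_two _))
  have hV0 : (V.erase 0).card ≤ V.card := Finset.card_erase_le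
  have hV0' : V.card ≤ (V.erase 0).card + 1 := by
    have := Finset.pred_card_le_card_erase (s := V) (a := 0)
    omega
  have hA := card_image_sq (X := V.erase 0) (by
    intro t ht
    obtain ⟨ht0, htV⟩ := Finset.mem_erase.1 ht
    obtain ⟨l, hl, rfl⟩ := Finset.mem_image.1 htV
    refine Finset.mem_erase.2 ⟨neg_ne_zero.2 ht0, Finset.mem_image.2 ⟨-l, by simpa using hl, ?_⟩⟩
    rw [inv_neg]; ring) (by simp)
  have hB := card_image_sq (X := Finset.univ.erase (0 : F)) (by simp) (by simp)
  refine ⟨(V.erase 0).image fun t => t ^ 2, (Finset.univ.erase (0 : F)).image fun t => t ^ 2,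
    ?_, ?_, ?_⟩
  · intro v
    simp only [Finset.mem_image, Finset.mem_erase, Finset.mem_univ, and_true, V]
    constructor
    · rintro ⟨_, ⟨h0, l, hl, rfl⟩, rfl⟩
      exact ⟨pow_ne_zero 2 h0, l, hl, rfl⟩
    · rintro ⟨h0, l, hl, rfl⟩
      exact ⟨_, ⟨fun h => h0 (by rw [h]; ring), l, hl, rfl⟩, rfl⟩
  · intro v
    simp only [Finset.mem_image, Finset.mem_erase, Finset.mem_univ, and_true]
    constructor
    · rintro ⟨t, h0, rfl⟩
      exact ⟨pow_ne_zero 2 h0, t, rfl⟩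
    · rintro ⟨h0, t, rfl⟩
      exact ⟨t, fun h => h0 (by rw [h]; ring), rfl⟩
  · have he : ({1, -1} : Finset F).card = 1 ∨ ({1, -1} : Finset F).card = 2 := by
      have h1 : 0 < ({1, -1} : Finset F).card := Finset.card_pos.2 ⟨1, by simp⟩
      have h2 : ({1, -1} : Finset F).card ≤ 2 := Finset.card_le_two
      omega
    rcases he with he | he <;> rw [he] at hA hB <;> omega

theorem PSL2.classTraceSq_mk_companion (t : F) :
    PSL2.classTraceSq (ConjClasses.mk (SL2.companion t : PSL(2, F))) = t ^ 2 := by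
  rw [PSL2.classTraceSq_mk, PSL2.traceSq_coe]
  simp [SL2.companion]

theorem PSL2.exists_classTraceSq_eq_sq (C : ConjClasses PSL(2, F)) :
    ∃ t : F, PSL2.classTraceSq C = t ^ 2 := by
  obtain ⟨g, rfl⟩ := ConjClasses.mk_surjective C
  obtain ⟨A, rfl⟩ := QuotientGroup.mk_surjective g
  exact ⟨_, rfl⟩

/-- There are about as many split as nonsplit classes, only boundedly many others, and at least
`q / 2` classes altogether. -/
theorem PSL2.card_classes (F : Type u) [Field F] [Finite F] :
    (PSL2.splitClasses F).ncard ≤ (PSL2.nonsplitClasses F).ncard + 7 ∧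
    (PSL2.nonsplitClasses F).ncard ≤ (PSL2.splitClasses F).ncard + 7 ∧
    Nat.card F ≤ 2 * Nat.card (ConjClasses PSL(2, F)) ∧
    Nat.card (ConjClasses PSL(2, F)) = (PSL2.splitClasses F).ncard +
      (PSL2.nonsplitClasses F).ncard +
      {C : ConjClasses PSL(2, F) | PSL2.classTraceSq C = 4}.ncard := by
  classical
  obtain ⟨A, B, hA, hB, h1, h2, h3⟩ := exists_card_squares F
  set S := PSL2.splitClasses F
  set T := PSL2.nonsplitClasses F
  have hST : S ∪ T = {C : ConjClasses PSL(2, F) | PSL2.classTraceSq C ≠ 4} := by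
    ext C
    simp only [S, T, PSL2.splitClasses, PSL2.nonsplitClasses, Set.mem_union, Set.mem_ofPred_eq]
    exact ⟨fun h => h.elim And.left And.left, fun h => (em _).imp (And.intro h) (And.intro h)⟩
  have hdisj : Disjoint S T := Set.disjoint_left.2 fun C hC hC' => hC'.2 hC.2
  have hcard : (S ∪ T).ncard = S.ncard + T.ncard := Set.ncard_union_eq hdisj
  have iS : Set.InjOn (PSL2.classTraceSq (F := F)) S :=
    PSL2.classTraceSq_injOn.mono fun C hC => hC.1
  have iST : Set.InjOn (PSL2.classTraceSq (F := F)) (S ∪ T) := by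
    rw [hST]; exact PSL2.classTraceSq_injOn
  have ins : ∀ (v : F) (X : Set F), (insert v X).ncard ≤ X.ncard + 1 := fun v X =>
    Set.ncard_insert_le v X
  have a1 : S.ncard ≤ A.card + 1 := by
    rw [← Set.InjOn.ncard_image iS, ← Set.ncard_coe_finset]
    refine (Set.ncard_le_ncard ?_ (Set.toFinite _)).trans (ins 0 _)
    rintro _ ⟨C, ⟨-, l, hl, h⟩, rfl⟩
    by_cases h0 : PSL2.classTraceSq C = 0
    · exact Or.inl h0
    · exact Or.inr ((hA _).2 ⟨h0, l, hl, h⟩)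
  have a2 : A.card ≤ S.ncard + 1 := by
    rw [← Set.InjOn.ncard_image iS, ← Set.ncard_coe_finset]
    refine (Set.ncard_le_ncard ?_ (Set.toFinite _)).trans (ins 4 _)
    intro v hv
    obtain ⟨-, l, hl, rfl⟩ := (hA v).1 hv
    by_cases h4 : (l + l⁻¹) ^ 2 = 4
    · exact Or.inl h4
    · have hc := PSL2.classTraceSq_mk_companion (l + l⁻¹)
      exact Or.inr ⟨_, ⟨by rw [hc]; exact h4, l, hl, hc⟩, hc⟩
  have b1 : (S ∪ T).ncard ≤ B.card + 1 := by
    rw [← Set.InjOn.ncard_image iST, ← Set.ncard_coe_finset]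
    refine (Set.ncard_le_ncard ?_ (Set.toFinite _)).trans (ins 0 _)
    rintro _ ⟨C, -, rfl⟩
    by_cases h0 : PSL2.classTraceSq C = 0
    · exact Or.inl h0
    · exact Or.inr ((hB _).2 ⟨h0, PSL2.exists_classTraceSq_eq_sq C⟩)
  have b2 : B.card ≤ (S ∪ T).ncard + 1 := by
    rw [← Set.InjOn.ncard_image iST, ← Set.ncard_coe_finset]
    refine (Set.ncard_le_ncard ?_ (Set.toFinite _)).trans (ins 4 _)
    intro v hv
    obtain ⟨-, t, rfl⟩ := (hB v).1 hv
    by_cases h4 : t ^ 2 = 4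
    · exact Or.inl h4
    · have hc := PSL2.classTraceSq_mk_companion t
      refine Or.inr ⟨_, ?_, hc⟩
      rw [hST]
      change PSL2.classTraceSq _ ≠ 4
      rw [hc]; exact h4
  have b3 : B.card + 1 ≤ Nat.card (ConjClasses PSL(2, F)) := by
    have h0 : (0 : F) ∉ B := fun h => ((hB 0).1 h).1 rfl
    rw [← Finset.card_insert_of_notMem h0, ← Set.ncard_coe_finset, ← Set.ncard_univ]
    refine (Set.ncard_le_ncard ?_ (Set.toFinite _)).trans
      (Set.ncard_image_le (f := PSL2.classTraceSq (F := F)) (Set.toFinite _))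
    intro v hv
    obtain ⟨t, rfl⟩ : ∃ t : F, v = t ^ 2 := by
      rcases Finset.mem_insert.1 hv with rfl | h
      · exact ⟨0, by ring⟩
      · exact ((hB v).1 h).2
    exact ⟨_, Set.mem_univ _, PSL2.classTraceSq_mk_companion t⟩
  refine ⟨by omega, by omega, by omega, ?_⟩
  rw [← hcard, hST, ← Set.ncard_add_ncard_compl
    {C : ConjClasses PSL(2, F) | PSL2.classTraceSq C ≠ 4}]
  congr 2
  ext C
  simp

end ClassCounts

/-! ### Counting pairs of classes -/

section PairCounts

universe u

theorem sum_pow_le_two_mul {b : ℕ} (hb : 2 ≤ b) (n : ℕ) :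
    ∑ j ∈ Finset.range (n + 1), b ^ j ≤ 2 * b ^ n := by
  induction n with
  | zero => simp
  | succ n ih =>
    rw [Finset.sum_range_succ, pow_succ]
    have := Nat.mul_le_mul_left (b ^ n) hb
    omega

/-- The split-nonsplit pairs of classes that do not invariably generate. -/
def PSL2.badPairs (F : Type u) [Field F] : Set (ConjClasses PSL(2, F) × ConjClasses PSL(2, F)) :=
  {p | p.1 ∈ PSL2.splitClasses F ∧ p.2 ∈ PSL2.nonsplitClasses F ∧ ¬InvariablyGenerates {p.1, p.2}}

/-- There are only `O(q)` bad pairs: a subfield of order `m`, with `m ^ 2 ≤ q`, accounts for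
fewer than `4 m ^ 2` of them, and the sum of `m ^ 2` over all subfields is `O(q)`. -/
theorem PSL2.ncard_badPairs_le (F : Type u) [Field F] [Finite F] :
    (PSL2.badPairs F).ncard ≤ 24 * Nat.card (ConjClasses PSL(2, F)) + 8 * Nat.card F := by
  classical
  have := Fintype.ofFinite F
  set p := ringChar F
  set q := Nat.card F
  set N := Nat.card (ConjClasses PSL(2, F))
  have hp : 2 ≤ p := (CharP.char_is_prime F p).two_le
  let P : ℕ → Set (ConjClasses PSL(2, F)) := fun n =>
    {C | PSL2.classTraceSq C ≠ 4 ∧ C.PowEqOne n}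
  have hP : ∀ n, 0 < n → (P n).ncard ≤ 2 * n := fun n hn => PSL2.ncard_powEqOne_le hn
  set L := Nat.log (p ^ 2) q
  let X : Set (ConjClasses PSL(2, F) × ConjClasses PSL(2, F)) :=
    ⋃ i ∈ Finset.Icc 1 3, (P i ×ˢ Set.univ ∪ Set.univ ×ˢ P i)
  let Y : Set (ConjClasses PSL(2, F) × ConjClasses PSL(2, F)) :=
    ⋃ j ∈ Finset.Icc 1 L, P (p ^ j - 1) ×ˢ P (p ^ j + 1)
  have hsub : PSL2.badPairs F ⊆ X ∪ Y := by
    rintro ⟨C, D⟩ ⟨hC, hD, h⟩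
    rcases PSL2.cases_of_not_invariablyGenerates hC hD h with
      ⟨i, hi, h | h⟩ | ⟨j, hj0, hjq, h1, h2⟩
    · exact Or.inl (Set.mem_biUnion hi (Or.inl ⟨⟨hC.1, h⟩, trivial⟩))
    · exact Or.inl (Set.mem_biUnion hi (Or.inr ⟨trivial, ⟨hD.1, h⟩⟩))
    · refine Or.inr (Set.mem_biUnion (Finset.mem_coe.2 (Finset.mem_Icc.2 ⟨by omega, ?_⟩))
        ⟨⟨hC.1, h1⟩, ⟨hD.1, h2⟩⟩)
      refine Nat.le_log_of_pow_le (by nlinarith) ?_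
      rwa [← pow_mul, mul_comm, pow_mul]
  have hX : X.ncard ≤ 24 * N := by
    have hi : ∀ i ∈ Finset.Icc 1 3, (P i ×ˢ Set.univ ∪ Set.univ ×ˢ P i).ncard ≤ 4 * i * N := by
      intro i hi
      have h1 := hP i (Finset.mem_Icc.1 hi).1
      have h2 := Nat.mul_le_mul_right N h1
      refine (Set.ncard_union_le _ _).trans ?_
      rw [Set.ncard_prod, Set.ncard_prod, Set.ncard_univ]
      change (P i).ncard * N + N * (P i).ncard ≤ _
      nlinarith
    refine (Finset.set_ncard_biUnion_le _ _).trans ((Finset.sum_le_sum hi).trans ?_)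
    rw [show Finset.Icc 1 3 = {1, 2, 3} by decide]
    simp
    omega
  have hY : Y.ncard ≤ 8 * q := by
    have hj : ∀ j ∈ Finset.Icc 1 L,
        (P (p ^ j - 1) ×ˢ P (p ^ j + 1)).ncard ≤ 4 * (p ^ 2) ^ j := by
      intro j hj
      have hm : 1 < p ^ j := Nat.one_lt_pow (by have := (Finset.mem_Icc.1 hj).1; omega) (by omega)
      rw [Set.ncard_prod]
      refine (Nat.mul_le_mul (hP _ (by omega)) (hP _ (by omega))).trans ?_
      rw [← pow_mul, mul_comm 2 j, pow_mul]
      obtain ⟨m, hm⟩ : ∃ m, p ^ j = m + 1 := ⟨p ^ j - 1, by omega⟩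
      rw [hm, Nat.add_sub_cancel]
      nlinarith
    refine (Finset.set_ncard_biUnion_le _ _).trans ((Finset.sum_le_sum hj).trans ?_)
    rw [← Finset.mul_sum]
    have h1 : ∑ j ∈ Finset.Icc 1 L, (p ^ 2) ^ j ≤ ∑ j ∈ Finset.range (L + 1), (p ^ 2) ^ j :=
      Finset.sum_le_sum_of_subset fun j hj => by
        have := (Finset.mem_Icc.1 hj).2
        exact Finset.mem_range.2 (by omega)
    have h2 := sum_pow_le_two_mul (b := p ^ 2) (by nlinarith) L
    have h3 : (p ^ 2) ^ L ≤ q := Nat.pow_log_le_self _ (Nat.card_pos (α := F)).ne'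
    omega
  have := Set.ncard_le_ncard hsub (Set.toFinite _)
  have := Set.ncard_union_le X Y
  omega

/-- The number of invariably generating pairs is that of split-nonsplit pairs, in either order,
up to a bounded multiple of the number of classes. -/
theorem PSL2.ncard_invariablyGenerates_bounds (F : Type u) [Field F] [Finite F] :
    let I := {p : ConjClasses PSL(2, F) × ConjClasses PSL(2, F) |
      InvariablyGenerates {p.1, p.2}}.ncard
    let st := (PSL2.splitClasses F).ncard * (PSL2.nonsplitClasses F).ncard
    let N := Nat.card (ConjClasses PSL(2, F))
    I ≤ 2 * st + 6 * N ∧ 2 * st ≤ I + 80 * N := by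
  intro I st N
  set S := PSL2.splitClasses F
  set T := PSL2.nonsplitClasses F
  set W := {C : ConjClasses PSL(2, F) | PSL2.classTraceSq C = 4}
  have hW : W.ncard ≤ 3 := PSL2.ncard_unipotent_classes_le
  have hSTW : ∀ C, C ∈ S ∨ C ∈ T ∨ C ∈ W := by
    intro C
    by_cases h4 : PSL2.classTraceSq C = 4
    · exact Or.inr (Or.inr h4)
    · by_cases h : ∃ l : F, l ≠ 0 ∧ PSL2.classTraceSq C = (l + l⁻¹) ^ 2
      · exact Or.inl ⟨h4, h⟩
      · exact Or.inr (Or.inl ⟨h4, h⟩)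
  have hdisj : Disjoint S T := Set.disjoint_left.2 fun C hC hC' => hC'.2 hC.2
  have hST : (S ×ˢ T ∪ T ×ˢ S).ncard = 2 * st := by
    rw [Set.ncard_union_eq (Set.disjoint_prod.2 (Or.inl hdisj)), Set.ncard_prod, Set.ncard_prod]
    change S.ncard * T.ncard + T.ncard * S.ncard = 2 * (S.ncard * T.ncard)
    ring
  have hWN := Nat.mul_le_mul_right N hW
  constructor
  · have hsub : {p : ConjClasses PSL(2, F) × ConjClasses PSL(2, F) |
        InvariablyGenerates {p.1, p.2}} ⊆
        (S ×ˢ T ∪ T ×ˢ S) ∪ (W ×ˢ Set.univ ∪ Set.univ ×ˢ W) := by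
      rintro ⟨C, D⟩ h
      rcases hSTW C with hC | hC | hC
      · rcases hSTW D with hD | hD | hD
        · exact absurd h (PSL2.not_invariablyGenerates_of_split hC hD)
        · exact Or.inl (Or.inl ⟨hC, hD⟩)
        · exact Or.inr (Or.inr ⟨trivial, hD⟩)
      · rcases hSTW D with hD | hD | hD
        · exact Or.inl (Or.inr ⟨hC, hD⟩)
        · exact absurd h (PSL2.not_invariablyGenerates_of_nonsplit hC hD)
        · exact Or.inr (Or.inr ⟨trivial, hD⟩)
      · exact Or.inr (Or.inl ⟨hC, trivial⟩)
    have h1 := Set.ncard_le_ncard hsub (Set.toFinite _)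
    have h2 := Set.ncard_union_le (S ×ˢ T ∪ T ×ˢ S)
      (W ×ˢ (Set.univ : Set (ConjClasses PSL(2, F))) ∪
        (Set.univ : Set (ConjClasses PSL(2, F))) ×ˢ W)
    have h3 := Set.ncard_union_le (W ×ˢ (Set.univ : Set (ConjClasses PSL(2, F))))
      ((Set.univ : Set (ConjClasses PSL(2, F))) ×ˢ W)
    rw [Set.ncard_prod, Set.ncard_prod, Set.ncard_univ, mul_comm (Nat.card _)] at h3
    change _ ≤ W.ncard * N + W.ncard * N at h3
    change I ≤ _ at h1
    omega
  · have hsub : S ×ˢ T ∪ T ×ˢ S ⊆ {p : ConjClasses PSL(2, F) × ConjClasses PSL(2, F) |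
        InvariablyGenerates {p.1, p.2}} ∪ (PSL2.badPairs F ∪ Prod.swap '' PSL2.badPairs F) := by
      rintro ⟨C, D⟩ hCD
      by_cases h : InvariablyGenerates {C, D}
      · exact Or.inl h
      · rcases hCD with ⟨hC, hD⟩ | ⟨hC, hD⟩
        · exact Or.inr (Or.inl ⟨hC, hD, h⟩)
        · refine Or.inr (Or.inr ⟨(D, C), ⟨hD, hC, ?_⟩, rfl⟩)
          rwa [Set.pair_comm]
    have h1 := Set.ncard_le_ncard hsub (Set.toFinite _)
    rw [hST] at h1
    have h2 := Set.ncard_union_le {p : ConjClasses PSL(2, F) × ConjClasses PSL(2, F) |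
        InvariablyGenerates {p.1, p.2}} (PSL2.badPairs F ∪ Prod.swap '' PSL2.badPairs F)
    have h3 := Set.ncard_union_le (PSL2.badPairs F) (Prod.swap '' PSL2.badPairs F)
    rw [Set.ncard_image_of_injective _ Prod.swap_injective] at h3
    have h4 := PSL2.ncard_badPairs_le F
    have h5 := (PSL2.card_classes F).2.2.1
    change _ ≤ I + _ at h2
    change _ ≤ 24 * N + _ at h4
    change _ ≤ 2 * N at h5
    omega

end PairCounts

theorem theorem1p2 :
    ∃ K : ℝ, ∀ (F : Type*) [Field F] [Finite F],
      |invariableGenerationProb (Matrix.ProjectiveSpecialLinearGroup (Fin 2) F) - 1 / 2| ≤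
        K / (Nat.card F : ℝ) := by
  refine ⟨200, fun F _ _ => ?_⟩
  obtain ⟨hI1, hI2⟩ := PSL2.ncard_invariablyGenerates_bounds F
  obtain ⟨hst, hts, hq, hN⟩ := PSL2.card_classes F
  have hw := PSL2.ncard_unipotent_classes_le (F := F)
  have hq2 : 1 < Nat.card F := Finite.one_lt_card
  unfold invariableGenerationProb
  have hcard : Nat.card {p : ConjClasses PSL(2, F) × ConjClasses PSL(2, F) //
      InvariablyGenerates {p.1, p.2}} = {p : ConjClasses PSL(2, F) × ConjClasses PSL(2, F) |
      InvariablyGenerates {p.1, p.2}}.ncard := Nat.card_coe_set_eq _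
  rw [hcard, Nat.card_prod]
  generalize {p : ConjClasses PSL(2, F) × ConjClasses PSL(2, F) |
      InvariablyGenerates {p.1, p.2}}.ncard = I at *
  generalize Nat.card (ConjClasses PSL(2, F)) = N at *
  generalize (PSL2.splitClasses F).ncard = s at *
  generalize (PSL2.nonsplitClasses F).ncard = t at *
  generalize {C : ConjClasses PSL(2, F) | PSL2.classTraceSq C = 4}.ncard = w at *
  generalize Nat.card F = q at *
  have hN1 : 1 ≤ N := by omega
  have r1 : (I : ℝ) ≤ 2 * (s * t) + 6 * N := by exact_mod_cast hI1
  have r2 : 2 * ((s : ℝ) * t) ≤ I + 80 * N := by exact_mod_cast hI2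
  have r3 : (s : ℝ) ≤ t + 7 := by exact_mod_cast hst
  have r4 : (t : ℝ) ≤ s + 7 := by exact_mod_cast hts
  have r5 : (q : ℝ) ≤ 2 * N := by exact_mod_cast hq
  have r6 : (N : ℝ) = s + t + w := by exact_mod_cast hN
  have r7 : (w : ℝ) ≤ 3 := by exact_mod_cast hw
  have s0 : (0 : ℝ) ≤ s := Nat.cast_nonneg s
  have t0 : (0 : ℝ) ≤ t := Nat.cast_nonneg t
  have w0 : (0 : ℝ) ≤ w := Nat.cast_nonneg w
  have hNpos : (0 : ℝ) < N := by exact_mod_cast hN1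
  have hqpos : (0 : ℝ) < q := by exact_mod_cast (by omega : 0 < q)
  -- `4 s t` is `N ^ 2` up to a multiple of `N`, because `s - t` and `N - (s + t)` are bounded
  have hup : 4 * ((s : ℝ) * t) ≤ N ^ 2 := by
    rw [r6]; nlinarith [sq_nonneg ((s : ℝ) - t), mul_nonneg s0 w0, mul_nonneg t0 w0]
  have hlow : (N : ℝ) ^ 2 ≤ 4 * ((s : ℝ) * t) + 13 * N := by
    have e1 : ((s : ℝ) - t) ^ 2 ≤ 7 * N := by
      have : |(s : ℝ) - t| ≤ 7 := abs_le.2 ⟨by linarith, by linarith⟩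
      have h' : |(s : ℝ) - t| ≤ N := abs_le.2 ⟨by linarith, by linarith⟩
      rw [← sq_abs, pow_two]
      exact mul_le_mul this h' (abs_nonneg _) (by norm_num)
    have e2 : (w : ℝ) * (N + s + t) ≤ 3 * (2 * N) := by
      apply mul_le_mul r7 (by linarith) (by linarith) (by norm_num)
    have e3 : (N : ℝ) ^ 2 = ((s : ℝ) - t) ^ 2 + 4 * (s * t) + w * (N + s + t) := by
      rw [r6]; ring
    linarith
  have habs : |(I : ℝ) - (N : ℝ) ^ 2 / 2| ≤ 100 * (N : ℝ) :=
    abs_le.2 ⟨by linarith, by linarith⟩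
  have hrw : (I : ℝ) / ((N * N : ℕ) : ℝ) - 1 / 2 =
      ((I : ℝ) - (N : ℝ) ^ 2 / 2) / (N : ℝ) ^ 2 := by
    push_cast
    field_simp
  rw [hrw, abs_div, abs_of_pos (pow_pos hNpos 2), div_le_div_iff₀ (pow_pos hNpos 2) hqpos]
  calc |(I : ℝ) - (N : ℝ) ^ 2 / 2| * (q : ℝ) ≤ (100 * (N : ℝ)) * (2 * (N : ℝ)) :=
        mul_le_mul habs r5 hqpos.le (by positivity)
    _ = 200 * (N : ℝ) ^ 2 := by ring
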